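/- Let $\{\psi_{lk}\}$ be an orthonormal boundary-corrected wavelet basis of $L^2[0,1]$: for some integers $J,N\ge 0$ with $2N\le 2^J$ it consists of $2^J$ scaling functions at resolution $2^J$, which are counted as being of level $l=0$, and, for every $l\ge J$, of $2^l$ wavelets of level $l$. At each resolution $2^l$ these functions are, up to $N$ boundary functions of the form $2^{l/2}g^{\mathrm{left}}_m(2^lx)$ and $N$ of the form $2^{l/2}g^{\mathrm{right}}_m(2^l(x-1))$ ($0\le m<N$), the functions $2^{l/2}g(2^lx-k)$, $N\le k<2^l-N$; here $g$ and the $g_m^{\mathrm{left}},g_m^{\mathrm{right}}$ do not depend on $l$ (one family for the scaling functions, one for the wavelets) and are measurable, bounded and compactly supported. Write $f_{lk}=\langle f,\psi_{lk}\rangle$ and, for $\beta,L>0$, $$\mathcal H^\beta(L)=\Big\{f\in L^2[0,1]:\ |f_{lk}|\le 2^{-l(1/2+\beta)}L\ \text{ for all } l,k\Big\}.$$ Let $\kappa\ge 0$, $c_1,c_2>0$ and let $h$ be a probability density on $\mathbb R$ that is symmetric, positive, bounded and decreasing on $[0,\infty)$, with $\log(1/h(x))\le c_1\big(1+\log^{1+\kappa}(1+x)\big)$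 for $x\ge 0$ and $\int_x^\infty h(u)\,du\le c_2/x^2$ for $x\ge 1$. Let $f=\sum_{l,k}s_l\zeta_{lk}\psi_{lk}$, where the $\zeta_{lk}$ are i.i.d. with density $h$, let $\beta,L>0$, and suppose that one of the following holds: 1. $s_l=2^{-l(1/2+\alpha)}$ with $\alpha>1/2$ and $\beta\le\alpha$; then set $$\varepsilon_n=(\log\log n)^{\frac{2}{1+2\beta}}(\log n)^{\frac{1+(1+\kappa)\beta}{1+2\beta}}n^{-\frac{\beta}{2\beta+1}};$$ 2. $s_l=2^{-l^2}$; then set $$\varepsilon_n=(\log n)^{\frac{(2+2\kappa)\beta}{1+2\beta}}n^{-\frac{\beta}{2\beta+1}}.$$ Then almost surely the series defining $f$ converges absolutely at every point of $[0,1]$ and $f$ is bounded, so that the law of $g_f=e^f/\int_0^1e^{f(u)}\,du$ is a prior $\Pi$ on probability densities on $[0,1]$. For data $X=(X_1,\dots,X_n)$ and $0<\rho<1$ let $$\Pi_\rho[B\mid X]=\frac{\int_B\big(\prod_{i=1}^n g(X_i)\big)^\rho\,d\Pi(g)}{\int\big(\prod_{i=1}^n g(X_i)\big)^\rho\,d\Pi(g)}$$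 be the $\rho$-tempered posterior. For every $\rho\in(0,1)$ there is a constant $M>0$ (depending on $\rho$, on $\beta,L$, on the basis and on the prior, but not on $g_0$) such that for every probability density $g_0$ on $[0,1]$ that is bounded away from $0$ and satisfies $\log g_0\in\mathcal H^\beta(L)$, $$E_{g_0}\,\Pi_\rho\big[\,\|g-g_0\|_1>M\varepsilon_n\mid X\,\big]\to 0\qquad(n\to\infty),$$ where under $E_{g_0}$ the observations $X_1,\dots,X_n$ are i.i.d. with density $g_0$. -/

import Mathlib

open MeasureTheory Filter Topology
open scoped ENNReal

noncomputable section

/-! ### Boundary-corrected wavelet bases of `L²[0,1]` -/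

/-- A generating function: measurable, bounded and compactly supported. -/
structure IsGenerator (g : ℝ → ℝ) : Prop where
  measurable : Measurable g
  bounded : ∃ C : ℝ, ∀ x, |g x| ≤ C
  compactSupport : HasCompactSupport g

/-- The `k`-th function (`0 ≤ k < 2 ^ l`) at resolution `2 ^ l` on `[0,1]` built from one interior
generator `g`, from `N` generators `gL` attached to the endpoint `0` and from `N` generators `gR`
attached to the endpoint `1`:
`2^{l/2} gL_k(2^l x)`, `2^{l/2} g(2^l x - k)` and `2^{l/2} gR_m(2^l (x - 1))`
respectively for `k < N`, `N ≤ k < 2^l - N` and `k = 2^l - N + m`. -/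
def boundaryDilate (N : ℕ) (gL : ℕ → ℝ → ℝ) (g : ℝ → ℝ) (gR : ℕ → ℝ → ℝ) (l k : ℕ)
    (x : unitInterval) : ℝ :=
  (2 : ℝ) ^ ((l : ℝ) / 2) *
    (if k < N then gL k (2 ^ l * (x : ℝ))
      else if k + N < 2 ^ l then g (2 ^ l * (x : ℝ) - k)
      else gR (k + N - 2 ^ l) (2 ^ l * ((x : ℝ) - 1)))

/-- Indices of a wavelet basis with coarsest scale `J`: `2 ^ J` scaling functions, and for each
`l ≥ J` (written `l = J + j`) the `2 ^ l` wavelets of level `l`. -/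
abbrev WaveletIndex (J : ℕ) : Type := Fin (2 ^ J) ⊕ (Σ j : ℕ, Fin (2 ^ (J + j)))

/-- The level `l` of an index: the scaling functions are counted as the first wavelets, of level
`0`. -/
def WaveletIndex.level {J : ℕ} : WaveletIndex J → ℕ
  | Sum.inl _ => 0
  | Sum.inr p => J + p.1

/-- An orthonormal boundary-corrected wavelet basis of `L²[0,1]`, with coarsest scale `J`:
in the interior it consists of the dyadic dilates and translates of a compactly supported
father wavelet `φ` (at the scale `J`) and mother wavelet `ψ` (at the scales `l ≥ J`), with `N`
modified functions of each kind at either endpoint. All Cohen-Daubechies-Vial bases are of this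
form, and so is the Haar basis (`N = 0`, `J = 0`). -/
structure BoundaryWaveletBasis where
  /-- coarsest scale -/
  J : ℕ
  /-- number of boundary functions at each endpoint -/
  N : ℕ
  two_mul_le : 2 * N ≤ 2 ^ J
  /-- father wavelet -/
  φ : ℝ → ℝ
  φLeft : ℕ → ℝ → ℝ
  φRight : ℕ → ℝ → ℝ
  /-- mother wavelet -/
  ψ : ℝ → ℝ
  ψLeft : ℕ → ℝ → ℝ
  ψRight : ℕ → ℝ → ℝ
  φ_gen : IsGenerator φ
  φLeft_gen : ∀ m < N, IsGenerator (φLeft m)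
  φRight_gen : ∀ m < N, IsGenerator (φRight m)
  ψ_gen : IsGenerator ψ
  ψLeft_gen : ∀ m < N, IsGenerator (ψLeft m)
  ψRight_gen : ∀ m < N, IsGenerator (ψRight m)
  /-- The system is an orthonormal basis of the Hilbert space `L²[0,1]`. -/
  isHilbertBasis :
    ∃ b : HilbertBasis (WaveletIndex J) ℝ (Lp ℝ 2 (volume : Measure unitInterval)),
      (∀ k : Fin (2 ^ J),
        b (Sum.inl k) =ᵐ[volume] boundaryDilate N φLeft φ φRight J k) ∧
      (∀ (j : ℕ) (k : Fin (2 ^ (J + j))),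
        b (Sum.inr ⟨j, k⟩) =ᵐ[volume] boundaryDilate N ψLeft ψ ψRight (J + j) k)

namespace BoundaryWaveletBasis

/-- The basis functions, as genuine functions on `[0,1]`. -/
def fn (W : BoundaryWaveletBasis) : WaveletIndex W.J → unitInterval → ℝ
  | Sum.inl k => boundaryDilate W.N W.φLeft W.φ W.φRight W.J k
  | Sum.inr p => boundaryDilate W.N W.ψLeft W.ψ W.ψRight (W.J + p.1) p.2

/-- The coefficient `⟨f, ψ_{lk}⟩`. -/
def coeff (W : BoundaryWaveletBasis) (f : unitInterval → ℝ) (i : WaveletIndex W.J) : ℝ :=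
  ∫ x, f x * W.fn i x

/-- The Hölder-type ball `H^β(L)`: `|f_{lk}| ≤ L 2^{-l(1/2+β)}` for all `l`, `k`. -/
def holderBall (W : BoundaryWaveletBasis) (β L : ℝ) : Set (unitInterval → ℝ) :=
  {f | MemLp f 2 volume ∧
    ∀ i, |W.coeff f i| ≤ (2 : ℝ) ^ (-(i.level : ℝ) * (1 / 2 + β)) * L}

/-- The function `f = ∑ f_{lk} ψ_{lk}` with coefficients `θ = (f_{lk})`. -/
def series (W : BoundaryWaveletBasis) (θ : WaveletIndex W.J → ℝ) (x : unitInterval) : ℝ :=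
  ∑' i, θ i * W.fn i x

end BoundaryWaveletBasis

/-! ### Heavy-tailed series priors -/

/-- A heavy-tailed density `h` on `ℝ`: symmetric, positive, bounded and decreasing on `[0,∞)`, with
`log (1/h(x)) ≤ c₁ (1 + log^{1+κ}(1+x))` for `x ≥ 0` and
`∫_x^∞ h ≤ c₂ / x²` for `x ≥ 1`. -/
structure HeavyTailedDensity (κ c₁ c₂ : ℝ) where
  h : ℝ → ℝ
  measurable : Measurable h
  lintegral_eq_one : ∫⁻ x, ENNReal.ofReal (h x) = 1
  symm : ∀ x, h (-x) = h x
  pos : ∀ x, 0 < h x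
  bounded : ∃ C : ℝ, ∀ x, h x ≤ C
  antitoneOn : AntitoneOn h (Set.Ici 0)
  log_inv_le : ∀ x, 0 ≤ x → Real.log (1 / h x) ≤ c₁ * (1 + Real.log (1 + x) ^ (1 + κ))
  tail_le : ∀ x, 1 ≤ x → ∫ u in Set.Ioi x, h u ≤ c₂ / x ^ 2

namespace HeavyTailedDensity

/-- The law `H` with density `h`. -/
def law {κ c₁ c₂ : ℝ} (H : HeavyTailedDensity κ c₁ c₂) : Measure ℝ :=
  volume.withDensity fun x => ENNReal.ofReal (H.h x)

instance instIsProbabilityMeasureLaw {κ c₁ c₂ : ℝ} (H : HeavyTailedDensity κ c₁ c₂) :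
    IsProbabilityMeasure H.law :=
  ⟨by rw [law, withDensity_apply _ MeasurableSet.univ, Measure.restrict_univ,
    H.lintegral_eq_one]⟩

end HeavyTailedDensity

/-- Scales of the `α`-heavy-tailed prior: `s_l = 2^{-l(1/2+α)}`. -/
def htScale (α : ℝ) (l : ℕ) : ℝ := (2 : ℝ) ^ (-(l : ℝ) * (1 / 2 + α))

/-- Scales of the oversmoothed heavy-tailed prior: `s_l = 2^{-l²}`. -/
def otScale (l : ℕ) : ℝ := (2 : ℝ) ^ (-(l : ℝ) ^ 2)

/-- The prior on coefficients: the law of `(s_l ζ_{lk})` for independent `ζ_{lk}` of law `H`. -/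
def seriesPrior (W : BoundaryWaveletBasis) {κ c₁ c₂ : ℝ} (H : HeavyTailedDensity κ c₁ c₂)
    (s : ℕ → ℝ) : Measure (WaveletIndex W.J → ℝ) :=
  (Measure.infinitePi fun _ : WaveletIndex W.J => H.law).map fun ζ i => s i.level * ζ i

/-! ### Density estimation and tempered posteriors -/

/-- Exponentiation and renormalisation: `g_f = e^f / ∫ e^f`. -/
def expDensity (f : unitInterval → ℝ) (x : unitInterval) : ℝ :=
  Real.exp (f x) / ∫ u, Real.exp (f u)

/-- The law on `[0,1]` with density `g`. -/
def densityLaw (g : unitInterval → ℝ) : Measure unitInterval :=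
  volume.withDensity fun x => ENNReal.ofReal (g x)

/-- The likelihood `∏ g(X_i)` of an i.i.d. sample from the density `g`. -/
def likelihood {n : ℕ} (g : unitInterval → ℝ) (X : Fin n → unitInterval) : ℝ≥0∞ :=
  ∏ i, ENNReal.ofReal (g (X i))

/-- The `ρ`-tempered posterior mass of `B`, given the likelihood function `p` of the parameter:
`∫_B p^ρ dΠ / ∫ p^ρ dΠ`. -/
def temperedPosterior {Θ : Type*} [MeasurableSpace Θ] (prior : Measure Θ) (ρ : ℝ)
    (p : Θ → ℝ≥0∞) (B : Set Θ) : ℝ≥0∞ :=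
  (∫⁻ θ in B, p θ ^ ρ ∂prior) / ∫⁻ θ, p θ ^ ρ ∂prior

/-- `E_{g₀} Π_ρ[ ‖g - g₀‖₁ > r | X₁, …, X_n ]`, for the prior on densities `g = g_f` with `f` drawn
from the series prior, and `X₁, …, X_n` i.i.d. with density `g₀`. -/
def expectedPosteriorMass (W : BoundaryWaveletBasis) {κ c₁ c₂ : ℝ}
    (H : HeavyTailedDensity κ c₁ c₂) (s : ℕ → ℝ) (ρ : ℝ) (g₀ : unitInterval → ℝ) (n : ℕ)
    (r : ℝ) : ℝ≥0∞ :=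
  ∫⁻ X : Fin n → unitInterval,
    temperedPosterior (seriesPrior W H s) ρ (fun θ => likelihood (expDensity (W.series θ)) X)
      {θ | ENNReal.ofReal r < eLpNorm (fun x => expDensity (W.series θ) x - g₀ x) 1 volume}
    ∂(Measure.pi fun _ => densityLaw g₀)

/-- `g₀` is a probability density on `[0,1]` that is bounded away from `0`. -/
structure IsDensityAwayFromZero (g₀ : unitInterval → ℝ) : Prop where
  measurable : Measurable g₀
  integral_eq_one : ∫ x, g₀ x = 1
  bounded_below : ∃ c : ℝ, 0 < c ∧ ∀ᵐ x, c ≤ g₀ x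

/-- The rate of the `α`-heavy-tailed prior. -/
def htRate (κ β : ℝ) (n : ℕ) : ℝ :=
  Real.log (Real.log n) ^ (2 / (1 + 2 * β)) *
    Real.log n ^ ((1 + (1 + κ) * β) / (1 + 2 * β)) * (n : ℝ) ^ (-(β / (2 * β + 1)))

/-- The rate of the oversmoothed heavy-tailed prior. -/
def otRate (κ β : ℝ) (n : ℕ) : ℝ :=
  Real.log n ^ ((2 + 2 * κ) * β / (1 + 2 * β)) * (n : ℝ) ^ (-(β / (2 * β + 1)))

/-- Under the prior, the wavelet series of almost every draw converges absolutely at every point of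
`[0,1]`, to a bounded function; thus the prior is carried by genuine densities `g_f`. -/
def PriorWellDefined (W : BoundaryWaveletBasis) {κ c₁ c₂ : ℝ}
    (H : HeavyTailedDensity κ c₁ c₂) (s : ℕ → ℝ) : Prop :=
  ∀ᵐ θ ∂(seriesPrior W H s),
    (∀ x, Summable fun i => θ i * W.fn i x) ∧ ∃ C : ℝ, ∀ x, |W.series θ x| ≤ C

end

noncomputable section

/-! ### Contraction of tempered posteriors -/

/-! For `ρ < 1` prior mass alone forces contraction; neither tests nor sieves are needed. Write the
posterior mass of `A = {‖g - g₀‖₁ > r}` as `N / D`, both normalised by the `ρ`-th power of the true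
likelihood. Since `N ≤ D`, the ratio is at most `t N + t⁻¹ D⁻¹` for every `t`. The expectation of
`N` integrates `n`-th powers of `ρ`-affinities over `A`, which are exponentially small there
(`lintegral_affinity_le`). Restricting `D` to a set `U` and applying Jensen bounds `D⁻¹` through
inverse likelihood ratios on `U`; if `f` is uniformly within `η` of `log g₀`, their expected `ρ`-th
powers are at most `exp (2nη²)` (`lintegral_inv_affinity_le`). So `n r²` only has to dominate `nη² -
log Π(U)` (`expectedPosteriorMass_le`).

The prior mass is bounded in `exists_exp_neg_le_seriesPrior`, where `U` is a box of coefficients cut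
at a level `K`. Each of the `O(2^K)` coefficients up to level `K` is placed near its target. Even if
the target is much larger than `s_l`, the heavy tail makes this cost only a power of `log (1/s_l)`,
hence `O((K+1)^p)` with `p = a(1+κ)`; this is the source of adaptation to `β`. Above `K` the
coefficients are merely confined to size `s_l 2^{(l-K)α'}` with `1/2 < α' < α`. The tail bound
`c₂/x²` makes this cost `O(2^K)` in total, and the uniform deviation is `O(2^{-Kβ})`. Balancing `n
2^{-2Kβ}` against `2^K (log n)^p` gives the rate, with `a = 1` for `htScale` and `a = 2` for
`otScale`. -/

theorem ENNReal.div_le_mul_add_inv_mul_inv {N D t : ℝ≥0∞} (hND : N ≤ D) (ht : t ≠ 0)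
    (ht' : t ≠ ∞) : N / D ≤ t * N + t⁻¹ * D⁻¹ := by
  -- A large `D` is used as a denominator; for a small `D` the trivial bound `N / D ≤ 1` is enough.
  rcases le_total D⁻¹ t with h | h
  · calc N / D = D⁻¹ * N := by rw [div_eq_mul_inv, mul_comm]
      _ ≤ t * N := by gcongr
      _ ≤ _ := le_self_add
  · calc N / D ≤ 1 := ENNReal.div_le_of_le_mul (by simpa using hND)
      _ = t⁻¹ * t := (ENNReal.inv_mul_cancel ht ht').symm
      _ ≤ t⁻¹ * D⁻¹ := by gcongr
      _ ≤ _ := le_add_self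

/-- Jensen's inequality for the inverse. -/
theorem MeasureTheory.inv_lintegral_le {Ω : Type*} [MeasurableSpace Ω] (μ : Measure Ω)
    {f : Ω → ℝ≥0∞} (hf : Measurable f) (h0 : ∀ᵐ ω ∂μ, f ω ≠ 0) (h1 : ∀ᵐ ω ∂μ, f ω ≠ ∞)
    (hμ0 : μ Set.univ ≠ 0) (hμ1 : μ Set.univ ≠ ∞) :
    (∫⁻ ω, f ω ∂μ)⁻¹ ≤ (μ Set.univ)⁻¹ ^ 2 * ∫⁻ ω, (f ω)⁻¹ ∂μ := by
  set A := ∫⁻ ω, f ω ∂μ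
  set B := ∫⁻ ω, (f ω)⁻¹ ∂μ
  set m := μ Set.univ
  -- Cauchy-Schwarz for `1 = f^{1/2} f^{-1/2}`.
  have hm : m ≤ A ^ (1 / 2 : ℝ) * B ^ (1 / 2 : ℝ) := by
    have h := ENNReal.lintegral_mul_le_Lp_mul_Lq μ (p := 2) (q := 2)
      (by rw [Real.holderConjugate_iff]; norm_num)
      (f := fun ω => f ω ^ (1 / 2 : ℝ)) (g := fun ω => (f ω)⁻¹ ^ (1 / 2 : ℝ))
      (hf.pow_const _).aemeasurable (hf.inv.pow_const _).aemeasurable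
    have e : ∫⁻ ω, ((fun ω => f ω ^ (1 / 2 : ℝ)) * (fun ω => (f ω)⁻¹ ^ (1 / 2 : ℝ))) ω ∂μ
        = m := by
      rw [show m = ∫⁻ _, 1 ∂μ by simp [m]]
      refine lintegral_congr_ae ?_
      filter_upwards [h0, h1] with ω h0 h1
      simp only [Pi.mul_apply]
      rw [← ENNReal.mul_rpow_of_nonneg _ _ (by norm_num), ENNReal.mul_inv_cancel h0 h1,
        ENNReal.one_rpow]
    rw [e] at h
    simpa only [← ENNReal.rpow_mul, one_div, inv_mul_cancel₀ (two_ne_zero' ℝ),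
      ENNReal.rpow_one] using h
  have hm2 : m ^ 2 ≤ A * B := by
    calc m ^ 2 ≤ (A ^ (1 / 2 : ℝ) * B ^ (1 / 2 : ℝ)) ^ 2 := by gcongr
      _ = A * B := by
        rw [mul_pow, ← ENNReal.rpow_natCast, ← ENNReal.rpow_natCast, ← ENNReal.rpow_mul,
          ← ENNReal.rpow_mul]
        norm_num
  by_cases hA : A = ∞
  · simp [hA]
  by_cases hA0 : A = 0
  · rw [hA0, zero_mul] at hm2
    exact absurd (by simpa using hm2) hμ0
  calc A⁻¹ = (m⁻¹ * m) ^ 2 * A⁻¹ := by rw [ENNReal.inv_mul_cancel hμ0 hμ1]; simp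
    _ = m⁻¹ ^ 2 * (m ^ 2 * A⁻¹) := by ring
    _ ≤ m⁻¹ ^ 2 * (A * B * A⁻¹) := by gcongr
    _ = m⁻¹ ^ 2 * (B * (A * A⁻¹)) := by ring
    _ = _ := by rw [ENNReal.mul_inv_cancel hA0 hA, mul_one]

theorem MeasureTheory.lintegral_pi_prod_const {𝒳 : Type*} [MeasurableSpace 𝒳] (P : Measure 𝒳)
    [IsProbabilityMeasure P] (n : ℕ) {F : 𝒳 → ℝ≥0∞} (hF : Measurable F) :
    ∫⁻ X, ∏ i, F (X i) ∂(Measure.pi fun _ : Fin n => P) = (∫⁻ x, F x ∂P) ^ n := by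
  rw [ProbabilityTheory.lintegral_prod_eq_prod_lintegral_of_indepFun Finset.univ
    (fun i (X : Fin n → 𝒳) => F (X i))
    (ProbabilityTheory.iIndepFun_pi (X := fun _ => F) fun _ => hF.aemeasurable)
    (fun i => hF.comp (measurable_pi_apply i))]
  have (i : Fin n) : ∫⁻ X : Fin n → 𝒳, F (X i) ∂(Measure.pi fun _ : Fin n => P)
      = ∫⁻ x, F x ∂P :=
    (measurePreserving_eval (fun _ : Fin n => P) i).lintegral_comp hF
  simp [this]

/-- A bound for the expected tempered posterior mass of `A`, in terms of `ρ`-affinities on `A` and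
of the prior mass of a set `U` on which inverse `ρ`-moments of likelihood ratios are controlled. -/
theorem lintegral_temperedPosterior_le {Θ 𝒳 : Type*} [MeasurableSpace Θ] [MeasurableSpace 𝒳]
    (prior : Measure Θ) [IsProbabilityMeasure prior] (P : Measure 𝒳) [IsProbabilityMeasure P]
    {ρ : ℝ} (hρ : 0 < ρ) {q : Θ → 𝒳 → ℝ≥0∞} (hq : Measurable (Function.uncurry q))
    {q₀ : 𝒳 → ℝ≥0∞} (hq₀ : Measurable q₀) (hq₀0 : ∀ x, q₀ x ≠ 0) (hq₀1 : ∀ x, q₀ x ≠ ∞)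
    {A U : Set Θ} (hU : MeasurableSet U) {a b t : ℝ≥0∞}
    (ha : ∀ᵐ θ ∂(prior.restrict A), ∫⁻ x, q θ x ^ ρ * (q₀ x ^ ρ)⁻¹ ∂P ≤ a)
    (hb : ∀ θ ∈ U, ∫⁻ x, q₀ x ^ ρ * (q θ x ^ ρ)⁻¹ ∂P ≤ b)
    (hU0 : ∀ θ ∈ U, ∀ x, q θ x ≠ 0) (hU1 : ∀ θ ∈ U, ∀ x, q θ x ≠ ∞)
    (hUp : prior U ≠ 0) (ht : t ≠ 0) (ht' : t ≠ ∞) (n : ℕ) :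
    ∫⁻ X : Fin n → 𝒳, temperedPosterior prior ρ (fun θ => ∏ i, q θ (X i)) A
      ∂(Measure.pi fun _ => P) ≤ t * a ^ n + t⁻¹ * ((prior U)⁻¹ * b ^ n) := by
  have hUt : prior U ≠ ∞ := measure_ne_top _ _
  set v : (Fin n → 𝒳) → ℝ≥0∞ := fun X => ∏ i, q₀ (X i) ^ ρ with hv
  set u : Θ → (Fin n → 𝒳) → ℝ≥0∞ := fun θ X => ∏ i, q θ (X i) ^ ρ with hu
  have hqi (i : Fin n) : Measurable fun p : Θ × (Fin n → 𝒳) => q p.1 (p.2 i) :=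
    hq.comp (measurable_fst.prodMk ((measurable_pi_apply i).comp measurable_snd))
  have hum : Measurable (Function.uncurry u) :=
    Finset.measurable_prod _ fun i _ => (hqi i).pow_const ρ
  have hvm : Measurable v :=
    Finset.measurable_prod _ fun i _ => (hq₀.comp (measurable_pi_apply i)).pow_const ρ
  have hv0 (X) : v X ≠ 0 := Finset.prod_ne_zero_iff.2 fun i _ => by
    simp [ENNReal.rpow_eq_zero_iff, hq₀0, hq₀1]
  have hv1 (X) : v X ≠ ∞ := ENNReal.prod_ne_top fun i _ => by
    simp [ENNReal.rpow_eq_top_iff, hq₀0, hq₀1]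
  have hu0 (θ) (hθ : θ ∈ U) (X) : u θ X ≠ 0 := Finset.prod_ne_zero_iff.2 fun i _ => by
    simp [ENNReal.rpow_eq_zero_iff, hU0 θ hθ, hU1 θ hθ]
  have hu1 (θ) (hθ : θ ∈ U) (X) : u θ X ≠ ∞ := ENNReal.prod_ne_top fun i _ => by
    simp [ENNReal.rpow_eq_top_iff, hU0 θ hθ, hU1 θ hθ]
  have huX (X) : Measurable fun θ => u θ X := hum.of_uncurry_right
  have huθ (θ) : Measurable (u θ) := hum.of_uncurry_left
  have hqθ (θ) : Measurable (q θ) := hq.of_uncurry_left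
  have pointwise (X : Fin n → 𝒳) :
      temperedPosterior prior ρ (fun θ => ∏ i, q θ (X i)) A ≤
        t * ∫⁻ θ in A, u θ X * (v X)⁻¹ ∂prior +
        t⁻¹ * ((prior U)⁻¹ ^ 2 * ∫⁻ θ in U, v X * (u θ X)⁻¹ ∂prior) := by
    have e (θ) : (∏ i, q θ (X i)) ^ ρ = u θ X := by
      simp only [hu, ENNReal.prod_rpow_of_nonneg hρ.le]
    simp only [temperedPosterior, e]
    -- The splitting level depends on the data: the factor `(v X)⁻¹` turns both terms into
    -- likelihood ratios against the truth.
    have h1 := ENNReal.div_le_mul_add_inv_mul_inv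
      (N := ∫⁻ θ in A, u θ X ∂prior) (D := ∫⁻ θ, u θ X ∂prior) (t := t * (v X)⁻¹)
      (setLIntegral_le_lintegral _ _) (by simp [ht, hv1]) (ENNReal.mul_ne_top ht' (by simp [hv0]))
    have h2 : (∫⁻ θ, u θ X ∂prior)⁻¹ ≤
        (prior U)⁻¹ ^ 2 * ∫⁻ θ in U, (u θ X)⁻¹ ∂prior := by
      calc (∫⁻ θ, u θ X ∂prior)⁻¹ ≤ (∫⁻ θ in U, u θ X ∂prior)⁻¹ :=
            ENNReal.inv_le_inv.2 (setLIntegral_le_lintegral _ _)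
        _ ≤ _ := by
          have := MeasureTheory.inv_lintegral_le (prior.restrict U) (huX X)
            ((ae_restrict_iff' hU).2 (Eventually.of_forall fun θ hθ => hu0 θ hθ X))
            ((ae_restrict_iff' hU).2 (Eventually.of_forall fun θ hθ => hu1 θ hθ X))
            (by simpa using hUp) (by simp)
          simpa using this
    refine h1.trans ?_
    rw [lintegral_mul_const _ (huX X), lintegral_const_mul (f := fun θ => (u θ X)⁻¹) _ (huX X).inv,
      ENNReal.mul_inv (Or.inl ht) (Or.inl ht'), inv_inv]
    calc _ ≤ t * (v X)⁻¹ * (∫⁻ θ in A, u θ X ∂prior) + t⁻¹ * v X *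
          ((prior U)⁻¹ ^ 2 * ∫⁻ θ in U, (u θ X)⁻¹ ∂prior) := by gcongr
      _ = _ := by ring
  have hm1 : Measurable (Function.uncurry fun (X : Fin n → 𝒳) θ => u θ X * (v X)⁻¹) :=
    (hum.comp measurable_swap).mul (hvm.comp measurable_fst).inv
  have hm2 : Measurable (Function.uncurry fun (X : Fin n → 𝒳) θ => v X * (u θ X)⁻¹) :=
    (hvm.comp measurable_fst).mul (hum.comp measurable_swap).inv
  have eu (θ) : ∫⁻ X, u θ X * (v X)⁻¹ ∂(Measure.pi fun _ : Fin n => P)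
      = (∫⁻ x, q θ x ^ ρ * (q₀ x ^ ρ)⁻¹ ∂P) ^ n := by
    rw [← MeasureTheory.lintegral_pi_prod_const P n
      (F := fun x => q θ x ^ ρ * (q₀ x ^ ρ)⁻¹) (((hqθ θ).pow_const ρ).mul (hq₀.pow_const ρ).inv)]
    refine lintegral_congr fun X => ?_
    simp only [hu, hv]
    rw [ENNReal.prod_inv_distrib, ← Finset.prod_mul_distrib]
    intro i _ j _ _
    left
    simp [ENNReal.rpow_eq_zero_iff, hq₀0, hq₀1]
  have ev (θ) (hθ : θ ∈ U) : ∫⁻ X, v X * (u θ X)⁻¹ ∂(Measure.pi fun _ : Fin n => P)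
      = (∫⁻ x, q₀ x ^ ρ * (q θ x ^ ρ)⁻¹ ∂P) ^ n := by
    rw [← MeasureTheory.lintegral_pi_prod_const P n
      (F := fun x => q₀ x ^ ρ * (q θ x ^ ρ)⁻¹) ((hq₀.pow_const ρ).mul ((hqθ θ).pow_const ρ).inv)]
    refine lintegral_congr fun X => ?_
    simp only [hu, hv]
    rw [ENNReal.prod_inv_distrib, ← Finset.prod_mul_distrib]
    intro i _ j _ _
    left
    simp [ENNReal.rpow_eq_zero_iff, hU0 θ hθ, hU1 θ hθ]
  calc _ ≤ ∫⁻ X, (t * ∫⁻ θ in A, u θ X * (v X)⁻¹ ∂prior +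
        t⁻¹ * ((prior U)⁻¹ ^ 2 * ∫⁻ θ in U, v X * (u θ X)⁻¹ ∂prior))
          ∂(Measure.pi fun _ : Fin n => P) := lintegral_mono pointwise
    _ = t * (∫⁻ θ in A, (∫⁻ X, u θ X * (v X)⁻¹ ∂(Measure.pi fun _ : Fin n => P)) ∂prior) +
        t⁻¹ * ((prior U)⁻¹ ^ 2 * ∫⁻ θ in U,
          (∫⁻ X, v X * (u θ X)⁻¹ ∂(Measure.pi fun _ : Fin n => P)) ∂prior) := by
      have m1 : Measurable fun X : Fin n → 𝒳 => ∫⁻ θ in A, u θ X * (v X)⁻¹ ∂prior :=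
        hm1.lintegral_prod_right
      have m2 : Measurable fun X : Fin n → 𝒳 => ∫⁻ θ in U, v X * (u θ X)⁻¹ ∂prior :=
        hm2.lintegral_prod_right
      rw [lintegral_add_left (m1.const_mul t), lintegral_const_mul _ m1,
        lintegral_const_mul _ (m2.const_mul _), lintegral_const_mul _ m2,
        lintegral_lintegral_swap hm1.aemeasurable, lintegral_lintegral_swap hm2.aemeasurable]
    _ ≤ t * (∫⁻ θ in A, a ^ n ∂prior) +
        t⁻¹ * ((prior U)⁻¹ ^ 2 * ∫⁻ θ in U, b ^ n ∂prior) := by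
      have i1 : ∫⁻ θ in A, (∫⁻ X, u θ X * (v X)⁻¹ ∂(Measure.pi fun _ : Fin n => P)) ∂prior ≤
          ∫⁻ θ in A, a ^ n ∂prior := by
        refine lintegral_mono_ae ?_
        filter_upwards [ha] with θ hθ
        rw [eu]
        gcongr
      have i2 : ∫⁻ θ in U, (∫⁻ X, v X * (u θ X)⁻¹ ∂(Measure.pi fun _ : Fin n => P)) ∂prior ≤
          ∫⁻ θ in U, b ^ n ∂prior := by
        refine setLIntegral_mono measurable_const fun θ hθ => ?_
        rw [ev θ hθ]
        gcongr
        exact hb θ hθ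
      gcongr
    _ ≤ _ := by
      rw [setLIntegral_const, setLIntegral_const]
      -- Integrating the constant over `U` gives back one of the two factors `(prior U)⁻¹` lost in
      -- Jensen's inequality.
      have e : (prior U)⁻¹ ^ 2 * (b ^ n * prior U) = (prior U)⁻¹ * b ^ n := by
        rw [sq, mul_assoc, mul_comm (b ^ n), ← mul_assoc ((prior U)⁻¹) (prior U),
          ENNReal.inv_mul_cancel hUp hUt, one_mul]
      rw [e]
      gcongr
      exact mul_le_of_le_one_right' prob_le_one

/-! ### Affinities of densities -/

/-- A refined weighted arithmetic-geometric mean inequality. -/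
theorem rpow_mul_rpow_add_le_weighted {ρ : ℝ} (hρ0 : 0 ≤ ρ) (hρ1 : ρ ≤ 1) {p q : ℝ} (hp : 0 ≤ p)
    (hq : 0 ≤ q) :
    p ^ ρ * q ^ (1 - ρ) + min ρ (1 - ρ) * (√p - √q) ^ 2 ≤ ρ * p + (1 - ρ) * q := by
  -- For `σ ≤ 1/2`, use the mean inequality for `√(xy)` and `y` with weights `2σ`, `1 - 2σ`, and
  -- `2√(xy) = x + y - (√x - √y)²`. The other half of the range follows by exchanging `p` and `q`.
  have key : ∀ {σ : ℝ}, 0 ≤ σ → σ ≤ 1 / 2 → ∀ {x y : ℝ}, 0 ≤ x → 0 ≤ y →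
      x ^ σ * y ^ (1 - σ) + σ * (√x - √y) ^ 2 ≤ σ * x + (1 - σ) * y := by
    intro σ h0 h1 x y hx hy
    have h := Real.geom_mean_le_arith_mean2_weighted (w₁ := 2 * σ) (w₂ := 1 - 2 * σ)
      (p₁ := √x * √y) (p₂ := y) (by linarith) (by linarith) (by positivity) hy (by ring)
    have e : x ^ σ * y ^ (1 - σ) = (√x * √y) ^ (2 * σ) * y ^ (1 - 2 * σ) := by
      rw [Real.mul_rpow (Real.sqrt_nonneg _) (Real.sqrt_nonneg _), Real.sqrt_eq_rpow,
        Real.sqrt_eq_rpow, ← Real.rpow_mul hx, ← Real.rpow_mul hy, mul_assoc,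
        ← Real.rpow_add_of_nonneg hy (by positivity) (by linarith)]
      ring_nf
    rw [e]
    nlinarith [Real.sq_sqrt hx, Real.sq_sqrt hy]
  rcases le_total ρ (1 / 2) with h | h
  · rw [min_eq_left (by linarith)]
    exact key hρ0 h hp hq
  · rw [min_eq_right (by linarith)]
    have := key (σ := 1 - ρ) (by linarith) (by linarith) hq hp
    rw [sub_sub_cancel] at this
    nlinarith

/-- A pointwise substitute for comparing Hellinger and `L¹` distances: factor `|p - q| = |√p - √q|
(√p + √q)`, then apply Young's inequality with free parameter `d`. For two densities at `L¹`
distance at least `d ≥ 0`, the bracket integrates to at least `d²/2 - d²/4 = d²/4`. -/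
theorem rpow_mul_rpow_add_abs_sub_le {ρ : ℝ} (hρ0 : 0 ≤ ρ) (hρ1 : ρ ≤ 1) {p q : ℝ} (hp : 0 ≤ p)
    (hq : 0 ≤ q) (d : ℝ) :
    p ^ ρ * q ^ (1 - ρ) ≤ ρ * p + (1 - ρ) * q -
      min ρ (1 - ρ) * (d / 2 * |p - q| - d ^ 2 / 8 * (p + q)) := by
  have h := rpow_mul_rpow_add_le_weighted hρ0 hρ1 hp hq
  have h2 : d / 2 * |p - q| - d ^ 2 / 8 * (p + q) ≤ (√p - √q) ^ 2 := by
    have hs : |p - q| = |√p - √q| * (√p + √q) := by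
      rw [← abs_of_nonneg (a := √p + √q) (by positivity), ← abs_mul]
      congr 1
      nlinarith [Real.sq_sqrt hp, Real.sq_sqrt hq]
    rw [hs, ← sq_abs (√p - √q)]
    nlinarith [Real.sq_sqrt hp, Real.sq_sqrt hq, sq_nonneg (|√p - √q| - d / 4 * (√p + √q)),
      mul_nonneg (sq_nonneg d) (sq_nonneg (√p - √q))]
  have := mul_le_mul_of_nonneg_left h2 (le_min hρ0 (sub_nonneg.2 hρ1))
  linarith

/-- Densities at `L¹` distance at least `d` have `ρ`-affinity at most `exp (-c d²)`. -/
theorem lintegral_affinity_le {Ω : Type*} [MeasurableSpace Ω] (μ : Measure Ω) {ρ : ℝ}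
    (hρ0 : 0 ≤ ρ) (hρ1 : ρ ≤ 1) {g g₀ : Ω → ℝ} (hgm : Measurable g) (hg₀m : Measurable g₀)
    (hg : Integrable g μ) (hg₀ : Integrable g₀ μ) (hpos : ∀ x, 0 ≤ g x) (hpos₀ : ∀ x, 0 < g₀ x)
    (h1 : ∫ x, g x ∂μ = 1) (h2 : ∫ x, g₀ x ∂μ = 1) {d : ℝ} (hd : 0 ≤ d)
    (hdist : d ≤ ∫ x, |g x - g₀ x| ∂μ) :
    ∫⁻ x, ENNReal.ofReal (g x) ^ ρ * (ENNReal.ofReal (g₀ x) ^ ρ)⁻¹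
        ∂(μ.withDensity fun x => ENNReal.ofReal (g₀ x)) ≤
      ENNReal.ofReal (Real.exp (-(min ρ (1 - ρ) / 4 * d ^ 2))) := by
  set r := min ρ (1 - ρ) with hr
  have hr0 : 0 ≤ r := le_min hρ0 (sub_nonneg.2 hρ1)
  set F : Ω → ℝ := fun x => ρ * g x + (1 - ρ) * g₀ x -
    r * (d / 2 * |g x - g₀ x| - d ^ 2 / 8 * (g x + g₀ x)) with hF
  have hFle (x) : g x ^ ρ * g₀ x ^ (1 - ρ) ≤ F x :=
    rpow_mul_rpow_add_abs_sub_le hρ0 hρ1 (hpos x) (hpos₀ x).le d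
  have hF0 (x) : 0 ≤ F x :=
    le_trans (mul_nonneg (Real.rpow_nonneg (hpos x) _) (Real.rpow_nonneg (hpos₀ x).le _)) (hFle x)
  have i1 : Integrable (fun x => |g x - g₀ x|) μ := (hg.sub hg₀).abs
  have i2 : Integrable (fun x => g x + g₀ x) μ := hg.add hg₀
  have i3 : Integrable (fun x => ρ * g x + (1 - ρ) * g₀ x) μ :=
    (hg.const_mul _).add (hg₀.const_mul _)
  have i4 : Integrable (fun x => d / 2 * |g x - g₀ x| - d ^ 2 / 8 * (g x + g₀ x)) μ :=
    (i1.const_mul _).sub (i2.const_mul _)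
  have hFi : Integrable F μ := i3.sub (i4.const_mul _)
  have hFint : ∫ x, F x ∂μ ≤ 1 - r / 4 * d ^ 2 := by
    rw [hF, integral_sub i3 (i4.const_mul _), integral_const_mul,
      integral_sub (i1.const_mul _) (i2.const_mul _), integral_const_mul, integral_const_mul,
      integral_add hg hg₀, integral_add (hg.const_mul _) (hg₀.const_mul _), integral_const_mul,
      integral_const_mul, h1, h2]
    have := mul_le_mul_of_nonneg_left hdist (mul_nonneg hr0 hd)
    nlinarith
  rw [lintegral_withDensity_eq_lintegral_mul _ hg₀m.ennreal_ofReal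
    (g := fun x => ENNReal.ofReal (g x) ^ ρ * (ENNReal.ofReal (g₀ x) ^ ρ)⁻¹)
    ((hgm.ennreal_ofReal.pow_const ρ).mul (hg₀m.ennreal_ofReal.pow_const ρ).inv)]
  calc _ ≤ ∫⁻ x, ENNReal.ofReal (F x) ∂μ := by
        refine lintegral_mono fun x => ?_
        simp only [Pi.mul_apply]
        rw [ENNReal.ofReal_rpow_of_nonneg (hpos x) hρ0, ENNReal.ofReal_rpow_of_pos (hpos₀ x),
          ← ENNReal.ofReal_inv_of_pos (Real.rpow_pos_of_pos (hpos₀ x) _),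
          ← ENNReal.ofReal_mul (Real.rpow_nonneg (hpos x) _), ← ENNReal.ofReal_mul (hpos₀ x).le]
        refine ENNReal.ofReal_le_ofReal (le_of_eq_of_le ?_ (hFle x))
        rw [Real.rpow_sub (hpos₀ x), Real.rpow_one]
        ring
    _ = ENNReal.ofReal (∫ x, F x ∂μ) :=
        (ofReal_integral_eq_lintegral_ofReal hFi (Eventually.of_forall hF0)).symm
    _ ≤ _ := by
        refine ENNReal.ofReal_le_ofReal (hFint.trans ?_)
        linarith [Real.add_one_le_exp (-(r / 4 * d ^ 2))]

/-- Inverse `ρ`-moments of likelihood ratios, for densities whose logarithms are uniformly close. -/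
theorem lintegral_inv_affinity_le {ρ : ℝ} (hρ0 : 0 ≤ ρ) (hρ1 : ρ ≤ 1) {f f₀ : unitInterval → ℝ}
    (hf : Measurable f) (hf₀ : Measurable f₀) (hi : Integrable (fun x => Real.exp (f₀ x)) volume)
    (h1 : ∫ x, Real.exp (f₀ x) = 1) {η : ℝ} (hη1 : η ≤ 1)
    (hdist : ∀ᵐ x, |f x - f₀ x| ≤ η) :
    ∫⁻ x, ENNReal.ofReal (Real.exp (f₀ x)) ^ ρ * (ENNReal.ofReal (expDensity f x) ^ ρ)⁻¹
        ∂(densityLaw fun x => Real.exp (f₀ x)) ≤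
      ENNReal.ofReal (Real.exp (2 * η ^ 2)) := by
  set w : unitInterval → ℝ := fun x => f x - f₀ x with hw
  have hwm : Measurable w := hf.sub hf₀
  have iw : Integrable (fun x => w x * Real.exp (f₀ x)) volume :=
    hi.bdd_mul hwm.aestronglyMeasurable (c := η) (by simpa using hdist)
  -- The mean `m` enters to first order both in `log Z` and in the moment of `e^{-ρw}`, with
  -- opposite signs after taking `Z ^ ρ`. It cancels, so the final exponent `(1 + ρ) η²` is
  -- quadratic in `η`.
  set m := ∫ x, w x * Real.exp (f₀ x) with hm
  set Z := ∫ x, Real.exp (f x) with hZ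
  have hexp {y : ℝ} (hy : |y| ≤ η) : Real.exp y ≤ 1 + y + η ^ 2 := by
    have := (abs_le.1 (Real.abs_exp_sub_one_sub_id_le (hy.trans hη1))).2
    have h2 : y ^ 2 ≤ η ^ 2 := sq_le_sq' (by linarith [(abs_le.1 hy).1]) (abs_le.1 hy).2
    linarith
  have iup : Integrable (fun x => (1 + η ^ 2) * Real.exp (f₀ x) + w x * Real.exp (f₀ x)) volume :=
    (hi.const_mul _).add iw
  have hle : ∀ᵐ x, Real.exp (f x) ≤
      (1 + η ^ 2) * Real.exp (f₀ x) + w x * Real.exp (f₀ x) := by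
    filter_upwards [hdist] with x hx
    have e : Real.exp (f x) = Real.exp (w x) * Real.exp (f₀ x) := by
      rw [← Real.exp_add]; simp [hw]
    rw [e]
    nlinarith [hexp hx, Real.exp_pos (f₀ x)]
  have ie : Integrable (fun x => Real.exp (f x)) volume := by
    refine iup.mono' (Real.measurable_exp.comp hf).aestronglyMeasurable ?_
    filter_upwards [hle] with x hx
    rwa [Real.norm_eq_abs, Real.abs_exp]
  have hZpos : 0 < Z := integral_exp_pos ie
  have hZle : Z ≤ Real.exp (m + η ^ 2) := by
    calc Z ≤ ∫ x, ((1 + η ^ 2) * Real.exp (f₀ x) + w x * Real.exp (f₀ x)) :=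
          integral_mono_ae ie iup hle
      _ = 1 + η ^ 2 + m := by
          rw [integral_add (hi.const_mul _) iw, integral_const_mul, h1, mul_one]
      _ ≤ _ := by linarith [Real.add_one_le_exp (m + η ^ 2)]
  set G : unitInterval → ℝ := fun x =>
    ((1 + η ^ 2) * Real.exp (f₀ x) - ρ * (w x * Real.exp (f₀ x))) * Z ^ ρ with hG
  have iG : Integrable G volume := ((hi.const_mul _).sub (iw.const_mul _)).mul_const _
  have hem : Measurable fun x => Real.exp (f₀ x) := Real.measurable_exp.comp hf₀
  have hdm : Measurable (expDensity f) := (Real.measurable_exp.comp hf).div_const _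
  have hdpos (x) : 0 < expDensity f x := div_pos (Real.exp_pos _) hZpos
  have hle2 : ∀ᵐ x, Real.exp (f₀ x) * (Real.exp (f₀ x) ^ ρ * (expDensity f x ^ ρ)⁻¹) ≤ G x := by
    filter_upwards [hdist] with x hx
    have e : Real.exp (f₀ x) * (Real.exp (f₀ x) ^ ρ * (expDensity f x ^ ρ)⁻¹) =
        Real.exp (f₀ x) * Real.exp (-(ρ * w x)) * Z ^ ρ := by
      rw [expDensity, Real.div_rpow (Real.exp_pos _).le hZpos.le, inv_div, ← Real.exp_mul,
        ← Real.exp_mul, div_eq_mul_inv, ← Real.exp_neg, mul_comm (Z ^ ρ), ← mul_assoc,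
        ← mul_assoc, mul_assoc (Real.exp (f₀ x)), ← Real.exp_add]
      congr 3
      simp only [hw]; ring
    rw [e, hG]
    have hx' : |-(ρ * w x)| ≤ η := by
      rw [abs_neg, abs_mul, abs_of_nonneg hρ0]
      exact (mul_le_of_le_one_left (abs_nonneg _) hρ1).trans hx
    have := hexp hx'
    refine mul_le_mul_of_nonneg_right ?_ (Real.rpow_nonneg hZpos.le _)
    nlinarith [Real.exp_pos (f₀ x)]
  rw [densityLaw, lintegral_withDensity_eq_lintegral_mul _ hem.ennreal_ofReal
    (g := fun x => ENNReal.ofReal (Real.exp (f₀ x)) ^ ρ * (ENNReal.ofReal (expDensity f x) ^ ρ)⁻¹)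
    ((hem.ennreal_ofReal.pow_const ρ).mul (hdm.ennreal_ofReal.pow_const ρ).inv)]
  calc _ ≤ ∫⁻ x, ENNReal.ofReal (G x) := by
        refine lintegral_mono_ae ?_
        filter_upwards [hle2] with x hx
        simp only [Pi.mul_apply]
        rw [ENNReal.ofReal_rpow_of_pos (Real.exp_pos _), ENNReal.ofReal_rpow_of_pos (hdpos x),
          ← ENNReal.ofReal_inv_of_pos (Real.rpow_pos_of_pos (hdpos x) _),
          ← ENNReal.ofReal_mul (by positivity), ← ENNReal.ofReal_mul (by positivity)]
        exact ENNReal.ofReal_le_ofReal hx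
    _ = ENNReal.ofReal (∫ x, G x) := by
        refine (ofReal_integral_eq_lintegral_ofReal iG ?_).symm
        filter_upwards [hle2] with x hx
        refine le_trans ?_ hx
        have := hdpos x
        positivity
    _ ≤ _ := by
        refine ENNReal.ofReal_le_ofReal ?_
        rw [hG, integral_mul_const, integral_sub (hi.const_mul _) (iw.const_mul _),
          integral_const_mul, integral_const_mul, h1, mul_one]
        calc (1 + η ^ 2 - ρ * m) * Z ^ ρ
            ≤ Real.exp (η ^ 2 - ρ * m) * Real.exp (ρ * (m + η ^ 2)) := by
              refine mul_le_mul ?_ ?_ (Real.rpow_nonneg hZpos.le _) (Real.exp_pos _).le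
              · linarith [Real.add_one_le_exp (η ^ 2 - ρ * m)]
              · calc Z ^ ρ ≤ Real.exp (m + η ^ 2) ^ ρ := Real.rpow_le_rpow hZpos.le hZle hρ0
                  _ = _ := by rw [← Real.exp_mul, mul_comm]
          _ = Real.exp (η ^ 2 + ρ * η ^ 2) := by rw [← Real.exp_add]; ring_nf
          _ ≤ _ := by
              refine Real.exp_le_exp.2 ?_
              nlinarith [sq_nonneg η]

/-! ### Wavelet series -/

theorem card_filter_abs_sub_le (n : ℕ) (y : ℝ) (R : ℕ) :
    (Finset.univ.filter fun k : Fin n => |y - (k : ℕ)| ≤ R).card ≤ 2 * R + 1 := by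
  calc (Finset.univ.filter fun k : Fin n => |y - (k : ℕ)| ≤ R).card
      ≤ (Finset.Icc ⌈y - R⌉ ⌊y + R⌋).card := by
        refine Finset.card_le_card_of_injOn (fun k => ((k : ℕ) : ℤ)) ?_ ?_
        · intro k hk
          have hk' := abs_le.1 (Finset.mem_filter.1 hk).2
          simp only [Finset.coe_Icc, Set.mem_Icc, Int.ceil_le, Int.le_floor, Int.cast_natCast]
          constructor <;> linarith
        · intro k _ k' _ h
          exact Fin.ext (Int.ofNat_injective h)
    _ ≤ 2 * R + 1 := by
        rw [Int.card_Icc, Int.toNat_le]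
        have h1 : (⌊y + R⌋ : ℝ) ≤ y + R := Int.floor_le _
        have h2 : y - R ≤ (⌈y - R⌉ : ℝ) := Int.le_ceil _
        have h3 : (⌊y + R⌋ : ℝ) - ⌈y - R⌉ ≤ 2 * R := by linarith
        have h4 : ⌊y + R⌋ - ⌈y - R⌉ ≤ 2 * (R : ℤ) := by exact_mod_cast h3
        push_cast
        linarith

theorem IsGenerator.exists_radius {g : ℝ → ℝ} (hg : IsGenerator g) :
    ∃ R : ℕ, ∀ x, (R : ℝ) < |x| → g x = 0 := by
  obtain ⟨r, hr⟩ := hg.compactSupport.isCompact.isBounded.subset_closedBall 0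
  obtain ⟨R, hR⟩ := exists_nat_ge r
  refine ⟨R, fun x hx => image_eq_zero_of_notMem_tsupport fun h => ?_⟩
  have := hr h
  rw [mem_closedBall_zero_iff, Real.norm_eq_abs] at this
  linarith

theorem exists_forall_abs_le_of_isGenerator {N : ℕ} {g : ℕ → ℝ → ℝ}
    (hg : ∀ m < N, IsGenerator (g m)) : ∃ C : ℝ, 0 ≤ C ∧ ∀ m < N, ∀ x, |g m x| ≤ C := by
  choose! C hC using fun m hm => (hg m hm).bounded
  refine ⟨∑ m ∈ Finset.range N, |C m|, Finset.sum_nonneg fun _ _ => abs_nonneg _,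
    fun m hm x => ((hC m hm x).trans (le_abs_self _)).trans ?_⟩
  exact Finset.single_le_sum (f := fun m => |C m|) (fun _ _ => abs_nonneg _)
    (Finset.mem_range.2 hm)

/-- The functions of one resolution level have bounded overlap. -/
theorem exists_sum_abs_boundaryDilate_le {N : ℕ} {gL gR : ℕ → ℝ → ℝ} {g : ℝ → ℝ}
    (hL : ∀ m < N, IsGenerator (gL m)) (hg : IsGenerator g) (hR : ∀ m < N, IsGenerator (gR m)) :
    ∃ D : ℝ, 0 ≤ D ∧ ∀ (l : ℕ) (x : unitInterval),
      ∑ k : Fin (2 ^ l), |boundaryDilate N gL g gR l k x| ≤ D * (2 : ℝ) ^ ((l : ℝ) / 2) := by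
  obtain ⟨CL, hCL0, hCL⟩ := exists_forall_abs_le_of_isGenerator hL
  obtain ⟨CR, hCR0, hCR⟩ := exists_forall_abs_le_of_isGenerator hR
  obtain ⟨C, hC⟩ := hg.bounded
  have hC0 : 0 ≤ C := (abs_nonneg _).trans (hC 0)
  obtain ⟨R, hR'⟩ := hg.exists_radius
  set B := CL + C + CR with hB
  refine ⟨(N + (N + (2 * R + 1))) * B, by positivity, fun l x => ?_⟩
  set y : ℝ := 2 ^ l * (x : ℝ) with hy
  -- Only three groups of indices can contribute at `x`: those of the left and right boundary
  -- functions, and the at most `2R + 1` translates that reach `y`.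
  set S₁ := Finset.univ.filter fun k : Fin (2 ^ l) => (k : ℕ) < N
  set S₂ := Finset.univ.filter fun k : Fin (2 ^ l) => 2 ^ l ≤ (k : ℕ) + N
  set S₃ := Finset.univ.filter fun k : Fin (2 ^ l) => |y - (k : ℕ)| ≤ R
  have hS₁ : S₁.card ≤ N := by
    calc S₁.card ≤ (Finset.range N).card :=
          Finset.card_le_card_of_injOn (fun k => (k : ℕ))
            (fun k hk => by simpa using (Finset.mem_filter.1 hk).2)
            (fun k _ k' _ h => Fin.ext h)
      _ = N := Finset.card_range N
  have hS₂ : S₂.card ≤ N := by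
    calc S₂.card ≤ (Finset.range N).card := by
          refine Finset.card_le_card_of_injOn (fun k => (k : ℕ) + N - 2 ^ l) ?_ ?_
          · intro k hk
            have h1 := (Finset.mem_filter.1 hk).2
            have h2 := k.2
            simp only [Finset.coe_range, Set.mem_Iio]
            omega
          · intro k hk k' hk' h
            have h1 := (Finset.mem_filter.1 hk).2
            have h2 := (Finset.mem_filter.1 hk').2
            refine Fin.ext ?_
            simp only at h
            omega
      _ = N := Finset.card_range N
  have hS₃ : S₃.card ≤ 2 * R + 1 := card_filter_abs_sub_le _ _ _
  have hzero : ∀ k ∉ S₁ ∪ (S₂ ∪ S₃), |boundaryDilate N gL g gR l (k : Fin (2 ^ l)) x| = 0 := by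
    intro k hk
    simp only [S₁, S₂, S₃, Finset.mem_union, Finset.mem_filter, Finset.mem_univ, true_and,
      not_or, not_lt, not_le] at hk
    rw [boundaryDilate, if_neg (not_lt.2 hk.1), if_pos hk.2.1, hR' _ hk.2.2]
    simp
  have hbound : ∀ k : Fin (2 ^ l),
      |boundaryDilate N gL g gR l k x| ≤ (2 : ℝ) ^ ((l : ℝ) / 2) * B := by
    intro k
    rw [boundaryDilate, abs_mul, abs_of_nonneg (by positivity)]
    refine mul_le_mul_of_nonneg_left ?_ (by positivity)
    split_ifs with h1 h2
    · have := hCL k h1 (2 ^ l * (x : ℝ))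
      linarith
    · have := hC (2 ^ l * (x : ℝ) - (k : ℕ))
      linarith
    · have := hCR ((k : ℕ) + N - 2 ^ l) (by have := k.2; omega) (2 ^ l * ((x : ℝ) - 1))
      linarith
  calc ∑ k : Fin (2 ^ l), |boundaryDilate N gL g gR l k x|
      = ∑ k ∈ S₁ ∪ (S₂ ∪ S₃), |boundaryDilate N gL g gR l (k : Fin (2 ^ l)) x| :=
        (Finset.sum_subset (Finset.subset_univ _) fun k _ hk => hzero k hk).symm
    _ ≤ (S₁ ∪ (S₂ ∪ S₃)).card • ((2 : ℝ) ^ ((l : ℝ) / 2) * B) :=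
        Finset.sum_le_card_nsmul _ _ _ fun k _ => hbound k
    _ ≤ (N + (N + (2 * R + 1)) : ℕ) • ((2 : ℝ) ^ ((l : ℝ) / 2) * B) := by
        refine nsmul_le_nsmul_left (by positivity) ?_
        refine (Finset.card_union_le _ _).trans (add_le_add hS₁ ?_)
        exact (Finset.card_union_le _ _).trans (add_le_add hS₂ hS₃)
    _ = _ := by rw [nsmul_eq_mul]; push_cast; ring

theorem measurable_boundaryDilate {N : ℕ} {gL gR : ℕ → ℝ → ℝ} {g : ℝ → ℝ}
    (hL : ∀ m < N, IsGenerator (gL m)) (hg : IsGenerator g) (hR : ∀ m < N, IsGenerator (gR m))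
    {l k : ℕ} (hk : k < 2 ^ l) : Measurable (boundaryDilate N gL g gR l k) := by
  unfold boundaryDilate
  refine Measurable.const_mul ?_ _
  split_ifs with h1 h2
  · exact (hL k h1).measurable.comp (by fun_prop)
  · exact hg.measurable.comp (by fun_prop)
  · exact (hR _ (by omega)).measurable.comp (by fun_prop)

theorem WaveletIndex.tsum_eq {J : ℕ} (F : WaveletIndex J → ℝ≥0∞) :
    ∑' i, F i = ∑ k, F (Sum.inl k) + ∑' j, ∑ k, F (Sum.inr ⟨j, k⟩) := by
  rw [Summable.tsum_sum ENNReal.summable ENNReal.summable, tsum_fintype, ENNReal.tsum_sigma']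
  simp_rw [tsum_fintype]

/-- The `2 ^ J` scaling functions all carry `b 0`, itself one term of the sum on the right; the
wavelets account for the additional `1`. -/
theorem WaveletIndex.tsum_level_le {J : ℕ} (b : ℕ → ℝ≥0∞) :
    ∑' i : WaveletIndex J, b i.level ≤ (2 ^ J + 1) * ∑' l, b l * 2 ^ l := by
  rw [WaveletIndex.tsum_eq, add_mul, one_mul]
  refine add_le_add ?_ ?_
  · simp only [WaveletIndex.level, Finset.sum_const, Finset.card_univ, Fintype.card_fin,
      nsmul_eq_mul]
    push_cast
    gcongr
    simpa using ENNReal.le_tsum (f := fun l => b l * 2 ^ l) 0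
  · simp only [WaveletIndex.level, Finset.sum_const, Finset.card_univ, Fintype.card_fin,
      nsmul_eq_mul]
    refine le_trans (le_of_eq ?_) (ENNReal.tsum_comp_le_tsum_of_injective
      (add_right_injective J) fun l => b l * 2 ^ l)
    exact tsum_congr fun j => by push_cast; rw [mul_comm]

namespace BoundaryWaveletBasis

variable (W : BoundaryWaveletBasis)

theorem measurable_fn (i : WaveletIndex W.J) : Measurable (W.fn i) := by
  rcases i with k | ⟨j, k⟩
  · exact measurable_boundaryDilate W.φLeft_gen W.φ_gen W.φRight_gen k.2
  · exact measurable_boundaryDilate W.ψLeft_gen W.ψ_gen W.ψRight_gen k.2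

theorem measurable_uncurry_series : Measurable (Function.uncurry W.series) :=
  Measurable.tsum fun i =>
    ((measurable_pi_apply i).comp measurable_fst).mul ((W.measurable_fn i).comp measurable_snd)

/-- Coefficients bounded by `a_l` at level `l` give a series bounded by a multiple of
`∑ a_l 2^{l/2}`. -/
theorem exists_tsum_mul_fn_le : ∃ D : ℝ, 0 < D ∧ ∀ (a : ℕ → ℝ≥0∞) (x : unitInterval),
    ∑' i, a i.level * ‖W.fn i x‖ₑ ≤
      ENNReal.ofReal D * ∑' l : ℕ, a l * ENNReal.ofReal ((2 : ℝ) ^ ((l : ℝ) / 2)) := by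
  obtain ⟨D₁, h1, hD₁⟩ := exists_sum_abs_boundaryDilate_le W.φLeft_gen W.φ_gen W.φRight_gen
  obtain ⟨D₂, h2, hD₂⟩ := exists_sum_abs_boundaryDilate_le W.ψLeft_gen W.ψ_gen W.ψRight_gen
  have henorm {N : ℕ} {gL gR : ℕ → ℝ → ℝ} {g : ℝ → ℝ} {D : ℝ}
      (hD : ∀ (l : ℕ) (x : unitInterval),
        ∑ k : Fin (2 ^ l), |boundaryDilate N gL g gR l k x| ≤ D * (2 : ℝ) ^ ((l : ℝ) / 2))
      (l : ℕ) (x : unitInterval) : ∑ k : Fin (2 ^ l), ‖boundaryDilate N gL g gR l k x‖ₑ ≤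
        ENNReal.ofReal (D * (2 : ℝ) ^ ((l : ℝ) / 2)) := by
    simp_rw [Real.enorm_eq_ofReal_abs]
    rw [← ENNReal.ofReal_sum_of_nonneg fun _ _ => abs_nonneg _]
    exact ENNReal.ofReal_le_ofReal (hD l x)
  -- Scaling functions have the size of resolution `2 ^ J` but are counted at level `0`, whence the
  -- factor `2^{J/2}`; the `1` only ensures positivity.
  refine ⟨D₁ * (2 : ℝ) ^ ((W.J : ℝ) / 2) + D₂ + 1, by positivity, fun a x => ?_⟩
  set T := ∑' l : ℕ, a l * ENNReal.ofReal ((2 : ℝ) ^ ((l : ℝ) / 2)) with hT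
  rw [WaveletIndex.tsum_eq]
  have e1 : ∑ k, a (WaveletIndex.level (J := W.J) (Sum.inl k)) * ‖W.fn (Sum.inl k) x‖ₑ ≤
      ENNReal.ofReal (D₁ * (2 : ℝ) ^ ((W.J : ℝ) / 2)) * T := by
    simp only [WaveletIndex.level, ← Finset.mul_sum]
    rw [mul_comm]
    refine mul_le_mul' (henorm hD₁ _ _) ?_
    simpa using ENNReal.le_tsum
      (f := fun l : ℕ => a l * ENNReal.ofReal ((2 : ℝ) ^ ((l : ℝ) / 2))) 0
  have e2 : ∑' j, ∑ k, a (WaveletIndex.level (J := W.J) (Sum.inr ⟨j, k⟩)) *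
      ‖W.fn (Sum.inr ⟨j, k⟩) x‖ₑ ≤ ENNReal.ofReal D₂ * T := by
    simp only [WaveletIndex.level, ← Finset.mul_sum]
    calc _ ≤ ∑' j, ENNReal.ofReal D₂ * (a (W.J + j) *
          ENNReal.ofReal ((2 : ℝ) ^ (((W.J + j : ℕ) : ℝ) / 2))) := by
          refine ENNReal.tsum_le_tsum fun j => ?_
          refine (mul_le_mul_right (henorm hD₂ (W.J + j) x) _).trans (le_of_eq ?_)
          rw [ENNReal.ofReal_mul h2]
          ring
      _ ≤ _ := by
          rw [ENNReal.tsum_mul_left]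
          gcongr
          exact ENNReal.tsum_comp_le_tsum_of_injective (add_right_injective W.J)
            fun l : ℕ => a l * ENNReal.ofReal ((2 : ℝ) ^ ((l : ℝ) / 2))
  refine (add_le_add e1 e2).trans ?_
  rw [← add_mul, ← ENNReal.ofReal_add (by positivity) h2]
  exact mul_le_mul' (ENNReal.ofReal_le_ofReal (by linarith)) le_rfl

theorem summable_of_tsum_enorm_ne_top {θ : WaveletIndex W.J → ℝ} {x : unitInterval}
    (h : ∑' i, ‖θ i‖ₑ * ‖W.fn i x‖ₑ ≠ ∞) : Summable fun i => θ i * W.fn i x :=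
  Summable.of_enorm (by simpa only [enorm_mul] using h)

/-- A function of the Hölder ball is almost everywhere the sum of its wavelet series. -/
theorem series_coeff_ae_eq {β L : ℝ} (hβ : 0 < β) {f : unitInterval → ℝ}
    (hf : f ∈ W.holderBall β L) :
    (∀ x, Summable fun i => W.coeff f i * W.fn i x) ∧ ∀ᵐ x, W.series (W.coeff f) x = f x := by
  obtain ⟨hf2, hfc⟩ := hf
  obtain ⟨D, hD0, hD⟩ := W.exists_tsum_mul_fn_le
  have hsum (x) : Summable fun i => W.coeff f i * W.fn i x := by
    refine W.summable_of_tsum_enorm_ne_top (ne_top_of_le_ne_top ?_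
      ((ENNReal.tsum_le_tsum fun i => ?_).trans
        (hD (fun l => ENNReal.ofReal ((2 : ℝ) ^ (-(l : ℝ) * (1 / 2 + β)) * L)) x)))
    · refine ENNReal.mul_ne_top ENNReal.ofReal_ne_top ?_
      have e (l : ℕ) : ENNReal.ofReal ((2 : ℝ) ^ (-(l : ℝ) * (1 / 2 + β)) * L) *
          ENNReal.ofReal ((2 : ℝ) ^ ((l : ℝ) / 2)) = ENNReal.ofReal (L * ((2 : ℝ) ^ (-β)) ^ l) := by
        rw [← ENNReal.ofReal_mul' (by positivity), ← Real.rpow_natCast, ← Real.rpow_mul (by simp),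
          mul_right_comm, ← Real.rpow_add (by simp), mul_comm L]
        congr 3
        ring
      simp_rw [e]
      exact (Summable.mul_left L (summable_geometric_of_lt_one (by positivity)
        (Real.rpow_lt_one_of_one_lt_of_neg (by norm_num) (by linarith)))).tsum_ofReal_ne_top
    · gcongr
      rw [Real.enorm_eq_ofReal_abs]
      exact ENNReal.ofReal_le_ofReal (hfc i)
  refine ⟨hsum, ?_⟩
  obtain ⟨b, hb1, hb2⟩ := W.isHilbertBasis
  have hb : ∀ᵐ x, ∀ i, b i x = W.fn i x := by
    refine ae_all_iff.2 fun i => ?_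
    rcases i with k | ⟨j, k⟩
    · exact hb1 k
    · exact hb2 j k
  set F : Lp ℝ 2 (volume : Measure unitInterval) := hf2.toLp f with hF
  have hFf : F =ᵐ[volume] f := hf2.coeFn_toLp
  have hcoef (i) : b.repr F i = W.coeff f i := by
    rw [HilbertBasis.repr_apply_apply, L2.inner_def, coeff]
    refine integral_congr_ae ?_
    filter_upwards [hb, hFf] with x h1 h2
    simp [h1 i, h2]
  have hpart (s : Finset (WaveletIndex W.J)) :
      ⇑(∑ i ∈ s, b.repr F i • b i) =ᵐ[volume] fun x => ∑ i ∈ s, W.coeff f i * W.fn i x := by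
    induction s using Finset.cons_induction with
    | empty =>
      simp only [Finset.sum_empty]
      exact Lp.coeFn_zero _ _ _
    | cons i s hi ih =>
      simp only [Finset.sum_cons]
      filter_upwards [Lp.coeFn_add (b.repr F i • b i) (∑ i ∈ s, b.repr F i • b i),
        Lp.coeFn_smul (b.repr F i) (b i), ih, hb] with x h1 h2 h3 h4
      rw [h1, Pi.add_apply, h2, h3, Pi.smul_apply, h4, hcoef, smul_eq_mul]
  -- Convergence in `L²` gives almost everywhere convergence along a sequence of finite partial
  -- sums, and pointwise summability identifies that limit with the sum of the series.
  obtain ⟨ns, hns, hlim⟩ :=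
    (tendstoInMeasure_of_tendsto_Lp (b.hasSum_repr F)).exists_seq_tendsto_ae'
  filter_upwards [hlim, ae_all_iff.2 hpart, hFf] with x h1 h2 h3
  rw [← h3]
  refine tendsto_nhds_unique ?_ h1
  have := (hsum x).hasSum.comp hns
  refine this.congr fun n => ?_
  exact (h2 (ns n)).symm

end BoundaryWaveletBasis

/-! ### Heavy-tailed laws -/

namespace HeavyTailedDensity

variable {κ c₁ c₂ : ℝ} (H : HeavyTailedDensity κ c₁ c₂)

theorem integrable : Integrable H.h volume := by
  refine ⟨H.measurable.aestronglyMeasurable, ?_⟩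
  rw [hasFiniteIntegral_iff_ofReal (Eventually.of_forall fun x => (H.pos x).le),
    H.lintegral_eq_one]
  exact ENNReal.one_lt_top

theorem law_apply {S : Set ℝ} (hS : MeasurableSet S) :
    H.law S = ENNReal.ofReal (∫ x in S, H.h x) := by
  rw [law, withDensity_apply _ hS, ofReal_integral_eq_lintegral_ofReal H.integrable.integrableOn
    (Eventually.of_forall fun x => (H.pos x).le)]

theorem exp_neg_le {x : ℝ} (hx : 0 ≤ x) :
    Real.exp (-(c₁ * (1 + Real.log (1 + x) ^ (1 + κ)))) ≤ H.h x := by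
  rw [← Real.le_log_iff_exp_le (H.pos x)]
  have := H.log_inv_le x hx
  rw [one_div, Real.log_inv] at this
  linarith

/-- By symmetry and monotonicity, `h` is at least `h (|y| + 1)` throughout an interval of radius at
most `1` about `y`. -/
theorem ofReal_le_law_ball (y : ℝ) {r : ℝ} (hr1 : r ≤ 1) :
    ENNReal.ofReal (2 * r * H.h (|y| + 1)) ≤ H.law {z | |z - y| ≤ r} := by
  have hset : {z : ℝ | |z - y| ≤ r} = Metric.closedBall y r := by
    ext z; simp [Real.dist_eq]
  rw [hset, law, withDensity_apply _ Metric.isClosed_closedBall.measurableSet]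
  calc ENNReal.ofReal (2 * r * H.h (|y| + 1))
      = ∫⁻ _ in Metric.closedBall y r, ENNReal.ofReal (H.h (|y| + 1)) := by
        rw [setLIntegral_const, Real.volume_closedBall, mul_comm,
          ENNReal.ofReal_mul (H.pos _).le]
    _ ≤ _ := by
        refine setLIntegral_mono H.measurable.ennreal_ofReal fun z hz => ?_
        refine ENNReal.ofReal_le_ofReal ?_
        rw [Metric.mem_closedBall, Real.dist_eq] at hz
        have hz' : |z| ≤ |y| + 1 := by
          have := abs_sub_abs_le_abs_sub z y
          linarith
        have hh : H.h |z| = H.h z := by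
          rcases abs_choice z with h | h <;> rw [h]
          exact H.symm z
        rw [← hh]
        exact H.antitoneOn (abs_nonneg z) ((abs_nonneg z).trans hz') hz'

theorem law_abs_gt_le {t : ℝ} (ht : 1 ≤ t) :
    H.law {z | t < |z|} ≤ ENNReal.ofReal (2 * c₂ / t ^ 2) := by
  have h0 : 0 ≤ ∫ u in Set.Ioi t, H.h u := integral_nonneg fun u => (H.pos u).le
  calc H.law {z | t < |z|} ≤ H.law (Set.Ioi t ∪ Set.Iic (-t)) := by
        refine measure_mono fun z (hz : t < |z|) => ?_
        rcases lt_abs.1 hz with h | h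
        · exact Or.inl h
        · exact Or.inr (by simp only [Set.mem_Iic]; linarith)
    _ ≤ H.law (Set.Ioi t) + H.law (Set.Iic (-t)) := measure_union_le _ _
    _ = ENNReal.ofReal (2 * ∫ u in Set.Ioi t, H.h u) := by
        rw [H.law_apply measurableSet_Ioi, H.law_apply measurableSet_Iic,
          ← integral_comp_neg_Ioi, two_mul, ENNReal.ofReal_add h0 h0]
        simp_rw [H.symm]
    _ ≤ _ := by
        refine ENNReal.ofReal_le_ofReal ?_
        have := H.tail_le t ht
        rw [mul_div_assoc]
        linarith

/-- The exponential form with exponent of order `t⁻²` lets such probabilities be multiplied over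
infinitely many coordinates. -/
theorem exists_exp_neg_le_law_abs_le (hc₂ : 0 < c₂) : ∃ C : ℝ, 0 < C ∧ ∀ t : ℝ, 1 ≤ t →
    ENNReal.ofReal (Real.exp (-(C / t ^ 2))) ≤ H.law {z | |z| ≤ t} := by
  obtain ⟨a, ha0, ha⟩ : ∃ a : ℝ, 0 < a ∧
      ENNReal.ofReal (Real.exp (-a)) ≤ H.law {z | |z| ≤ 1} := by
    have h := H.ofReal_le_law_ball 0 (r := 1) le_rfl
    simp only [sub_zero, abs_zero, zero_add, mul_one] at h
    refine ⟨|Real.log (2 * H.h 1)| + 1, by positivity, le_trans (ENNReal.ofReal_le_ofReal ?_) h⟩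
    have hp : 0 < 2 * H.h 1 := by linarith [H.pos 1]
    rw [← Real.le_log_iff_exp_le hp]
    linarith [neg_abs_le (Real.log (2 * H.h 1))]
  -- One constant for two regimes. If `t² ≤ 4c₂`, the exponent is at least `a` and the mass of
  -- `[-1,1]` suffices. Otherwise `q = 2c₂/t² ≤ 1/2`, and `1 - q ≥ e^{-2q}`.
  refine ⟨4 * c₂ * (1 + a), by positivity, fun t ht => ?_⟩
  have ht2 : 0 < t ^ 2 := by positivity
  rcases le_or_gt (t ^ 2) (4 * c₂) with h | h
  · calc _ ≤ ENNReal.ofReal (Real.exp (-a)) := by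
          refine ENNReal.ofReal_le_ofReal (Real.exp_le_exp.2 (neg_le_neg ?_))
          rw [le_div_iff₀ ht2]
          nlinarith
      _ ≤ _ := ha
      _ ≤ _ := measure_mono fun z hz => le_trans hz ht
  · have hq : 2 * c₂ / t ^ 2 ≤ 1 / 2 := by rw [div_le_iff₀ ht2]; linarith
    have hq0 : 0 ≤ 2 * c₂ / t ^ 2 := by positivity
    have hcompl : {z : ℝ | |z| ≤ t} = {z : ℝ | t < |z|}ᶜ := by ext z; simp
    have hm : MeasurableSet {z : ℝ | t < |z|} := measurableSet_lt measurable_const measurable_abs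
    rw [hcompl, prob_compl_eq_one_sub hm]
    refine le_trans ?_ (tsub_le_tsub_left (H.law_abs_gt_le ht) 1)
    rw [← ENNReal.ofReal_one, ← ENNReal.ofReal_sub _ hq0]
    refine ENNReal.ofReal_le_ofReal ?_
    set q := 2 * c₂ / t ^ 2
    calc Real.exp (-(4 * c₂ * (1 + a) / t ^ 2)) ≤ Real.exp (-(2 * q)) := by
          refine Real.exp_le_exp.2 (neg_le_neg ?_)
          have : 4 * c₂ * (1 + a) / t ^ 2 = 2 * q * (1 + a) := by simp only [q]; ring
          rw [this]
          nlinarith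
      _ ≤ 1 - q := by
          rw [Real.exp_neg, inv_le_comm₀ (Real.exp_pos _) (by linarith)]
          calc (1 - q)⁻¹ ≤ 1 + 2 * q := by
                rw [inv_le_iff_one_le_mul₀ (by linarith)]
                nlinarith
            _ ≤ _ := by linarith [Real.add_one_le_exp (2 * q)]

/-- Small ball probabilities for a scaled variable. -/
theorem exp_neg_le_law_scaled_ball (hκ : 0 ≤ κ) (hc₁ : 0 < c₁) {s y L δ : ℝ} (hs0 : 0 < s)
    (hs1 : s ≤ 1) (hy : |y| ≤ L) (hδ0 : 0 < δ) (hδ1 : δ ≤ 1) :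
    ENNReal.ofReal (Real.exp (-(c₁ * (1 + (Real.log (2 + L) + Real.log (1 / s)) ^ (1 + κ)) +
      Real.log (1 / δ)))) ≤ H.law {z | |s * z - y| ≤ δ} := by
  have hL : 0 ≤ L := (abs_nonneg y).trans hy
  have hx0 : 0 ≤ |y / s| + 1 := by positivity
  calc _ ≤ ENNReal.ofReal (2 * δ * H.h (|y / s| + 1)) := by
        refine ENNReal.ofReal_le_ofReal ?_
        have hlog : Real.log (1 + (|y / s| + 1)) ≤ Real.log (2 + L) + Real.log (1 / s) := by
          rw [← Real.log_mul (by positivity) (by positivity)]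
          refine Real.log_le_log (by positivity) ?_
          rw [abs_div, abs_of_pos hs0, mul_one_div, le_div_iff₀ hs0, add_mul, add_mul,
            div_mul_cancel₀ _ hs0.ne']
          linarith
        have hlog0 : 0 ≤ Real.log (1 + (|y / s| + 1)) := Real.log_nonneg (by linarith)
        have h1 := H.exp_neg_le hx0
        have h2 : Real.exp (-(c₁ * (1 + (Real.log (2 + L) + Real.log (1 / s)) ^ (1 + κ)))) ≤
            H.h (|y / s| + 1) := by
          refine le_trans (Real.exp_le_exp.2 ?_) h1
          have := Real.rpow_le_rpow hlog0 hlog (by linarith : 0 ≤ 1 + κ)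
          nlinarith
        rw [neg_add, Real.exp_add, one_div δ, Real.log_inv, neg_neg, Real.exp_log hδ0]
        nlinarith [H.pos (|y / s| + 1)]
    -- Radius `δ` rather than `δ / s`: it stays at most `1`, and it suffices because `s ≤ 1`.
    _ ≤ H.law {z | |z - y / s| ≤ δ} := H.ofReal_le_law_ball _ hδ1
    _ ≤ _ := by
        refine measure_mono fun z (hz : |z - y / s| ≤ δ) => ?_
        have e : s * z - y = s * (z - y / s) := by field_simp
        simp only [Set.mem_ofPred_eq]
        rw [e, abs_mul, abs_of_pos hs0]
        exact (mul_le_of_le_one_left (abs_nonneg _) hs1).trans hz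

end HeavyTailedDensity

/-! ### The series prior -/

theorem seriesPrior_eq_infinitePi (W : BoundaryWaveletBasis) {κ c₁ c₂ : ℝ}
    (H : HeavyTailedDensity κ c₁ c₂) (s : ℕ → ℝ) :
    seriesPrior W H s =
      Measure.infinitePi fun i : WaveletIndex W.J => H.law.map fun z => s i.level * z :=
  Measure.infinitePi_map_pi (fun _ : WaveletIndex W.J => H.law)
    (f := fun i z => s i.level * z) fun _ => measurable_const_mul _

instance instIsProbabilityMeasureSeriesPrior (W : BoundaryWaveletBasis) {κ c₁ c₂ : ℝ}
    (H : HeavyTailedDensity κ c₁ c₂) (s : ℕ → ℝ) : IsProbabilityMeasure (seriesPrior W H s) :=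
  Measure.isProbabilityMeasure_map
    (measurable_pi_lambda _ fun i => (measurable_pi_apply i).const_mul _).aemeasurable

theorem seriesPrior_eval (W : BoundaryWaveletBasis) {κ c₁ c₂ : ℝ}
    (H : HeavyTailedDensity κ c₁ c₂) (s : ℕ → ℝ) (i : WaveletIndex W.J) {S : Set ℝ}
    (hS : MeasurableSet S) :
    seriesPrior W H s {θ | θ i ∈ S} = H.law {z | s i.level * z ∈ S} := by
  have (i : WaveletIndex W.J) : IsProbabilityMeasure (H.law.map fun z => s i.level * z) :=
    Measure.isProbabilityMeasure_map (measurable_const_mul _).aemeasurable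
  have h := (measurePreserving_eval_infinitePi
    (fun i : WaveletIndex W.J => H.law.map fun z => s i.level * z) i).measure_preimage
      hS.nullMeasurableSet
  rw [Measure.map_apply (measurable_const_mul _) hS] at h
  rw [seriesPrior_eq_infinitePi]
  exact h

/-- The factors are at most `1`, so the infinite product is the infimum of its finite subproducts,
each at least the exponential of minus a partial sum of `b`. -/
theorem MeasureTheory.Measure.exp_neg_le_infinitePi_pi {ι : Type*} [Countable ι]
    {X : ι → Type*} [∀ i, MeasurableSpace (X i)] (μ : ∀ i, Measure (X i))
    [∀ i, IsProbabilityMeasure (μ i)] {T : ∀ i, Set (X i)} (hT : ∀ i, MeasurableSet (T i))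
    {b : ι → ℝ} (hb0 : ∀ i, 0 ≤ b i)
    (hb : ∀ i, ENNReal.ofReal (Real.exp (-b i)) ≤ μ i (T i)) {B : ℝ} (hB0 : 0 ≤ B)
    (hB : ∑' i, ENNReal.ofReal (b i) ≤ ENNReal.ofReal B) :
    ENNReal.ofReal (Real.exp (-B)) ≤ Measure.infinitePi μ (Set.univ.pi T) := by
  rw [Measure.infinitePi_pi_univ _ hT, ENNReal.tprod_eq_iInf_prod fun _ => prob_le_one]
  refine le_iInf fun F => ?_
  calc ENNReal.ofReal (Real.exp (-B)) ≤ ENNReal.ofReal (Real.exp (-∑ i ∈ F, b i)) := by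
        refine ENNReal.ofReal_le_ofReal (Real.exp_le_exp.2 (neg_le_neg ?_))
        rw [← ENNReal.ofReal_le_ofReal_iff hB0, ENNReal.ofReal_sum_of_nonneg fun i _ => hb0 i]
        exact (ENNReal.sum_le_tsum F).trans hB
    _ = ∏ i ∈ F, ENNReal.ofReal (Real.exp (-b i)) := by
        rw [← ENNReal.ofReal_prod_of_nonneg fun _ _ => (Real.exp_pos _).le, ← Real.exp_sum,
          Finset.sum_neg_distrib]
    _ ≤ _ := Finset.prod_le_prod' fun i _ => hb i

/-! ### Prior mass of uniform neighbourhoods -/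

/-- Scales decaying at least like `2^{-l(1/2+α)}`, and no faster than `exp (-A (l+1)^a)`. -/
structure RegularScale (s : ℕ → ℝ) (α a : ℝ) : Prop where
  pos : ∀ l, 0 < s l
  le_one : ∀ l, s l ≤ 1
  decay : ∃ C : ℝ, 0 ≤ C ∧ ∀ l : ℕ, s l ≤ C * (2 : ℝ) ^ (-(l : ℝ) * (1 / 2 + α))
  log_inv_le : ∃ A : ℝ, 0 ≤ A ∧ ∀ l : ℕ, Real.log (1 / s l) ≤ A * ((l : ℝ) + 1) ^ a

theorem ENNReal.tsum_le_ofReal_of_geometric_tail {F : ℕ → ℝ≥0∞} {K : ℕ} {A B r : ℝ} (hA : 0 ≤ A)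
    (hB : 0 ≤ B) (hr0 : 0 ≤ r) (hr1 : r < 1)
    (h1 : ∑ l ∈ Finset.range (K + 1), F l ≤ ENNReal.ofReal A)
    (h2 : ∀ m, F (m + (K + 1)) ≤ ENNReal.ofReal (B * r ^ m)) :
    ∑' l, F l ≤ ENNReal.ofReal (A + B * (1 - r)⁻¹) := by
  have hg : Summable fun m : ℕ => B * r ^ m :=
    (summable_geometric_of_lt_one hr0 hr1).mul_left B
  rw [← Summable.sum_add_tsum_nat_add' (k := K + 1) ENNReal.summable,
    ENNReal.ofReal_add hA (mul_nonneg hB (inv_nonneg.2 (sub_nonneg.2 hr1.le)))]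
  refine add_le_add h1 ((ENNReal.tsum_le_tsum h2).trans (le_of_eq ?_))
  rw [← ENNReal.ofReal_tsum_of_nonneg (fun m => by positivity) hg, tsum_mul_left,
    tsum_geometric_of_lt_one hr0 hr1]

/-- The price of the precision demanded of one coefficient is linear in `K`, hence absorbed by `(K +
1)^p` with `p ≥ 1`. -/
theorem log_inv_resolution_le {β : ℝ} (hβ : 0 < β) {K l : ℕ} (hl : l ≤ K) :
    Real.log (1 / ((2 : ℝ) ^ (-(K * β) - (l : ℝ) / 2) / (K + 1))) ≤ (β + 2) * (K + 1) := by
  have hK : (0 : ℝ) < K + 1 := by positivity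
  have hlK : (l : ℝ) ≤ K := by exact_mod_cast hl
  have hl0 : (0 : ℝ) ≤ l := by positivity
  have e : 1 / ((2 : ℝ) ^ (-(K * β) - (l : ℝ) / 2) / (K + 1)) =
      (K + 1) * (2 : ℝ) ^ (K * β + (l : ℝ) / 2) := by
    rw [one_div_div, div_eq_mul_inv, ← Real.rpow_neg (by norm_num)]
    congr 2
    ring
  rw [e, Real.log_mul hK.ne' (by positivity), Real.log_rpow (by norm_num)]
  have h1 : Real.log (K + 1) ≤ K := by linarith [Real.log_le_sub_one_of_pos hK]
  have h2 : Real.log 2 ≤ 1 := by linarith [Real.log_two_lt_d9]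
  have h3 : (K * β + (l : ℝ) / 2) * Real.log 2 ≤ (K * β + (l : ℝ) / 2) * 1 :=
    mul_le_mul_of_nonneg_left h2 (by positivity)
  nlinarith

/-- The weighted sum of the allowed deviations of the coefficients from their targets: at most
`2^{-Kβ-l/2}/(K+1)` up to level `K`, and of the size of the scales beyond. -/
theorem tsum_deviation_le {s : ℕ → ℝ} {α α' β L C : ℝ} (hα' : α' < α) (hβ : 0 < β) (hβα : β ≤ α)
    (hL : 0 ≤ L) (hC0 : 0 ≤ C) (hC : ∀ l : ℕ, s l ≤ C * (2 : ℝ) ^ (-(l : ℝ) * (1 / 2 + α)))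
    (K : ℕ) :
    ∑' l : ℕ, ENNReal.ofReal (if l ≤ K then (2 : ℝ) ^ (-(K * β) - (l : ℝ) / 2) / (K + 1)
        else s l * (2 : ℝ) ^ (((l : ℝ) - K) * α') + (2 : ℝ) ^ (-(l : ℝ) * (1 / 2 + β)) * L) *
      ENNReal.ofReal ((2 : ℝ) ^ ((l : ℝ) / 2)) ≤
    ENNReal.ofReal ((1 + (C + L) *
      (1 - max ((2 : ℝ) ^ (-(α - α'))) ((2 : ℝ) ^ (-β)))⁻¹) * (2 : ℝ) ^ (-(K * β))) := by
  -- Beyond level `K`, `r₁` is the decay ratio of the allowed draws and `r₂` that of the target.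
  set r₁ : ℝ := (2 : ℝ) ^ (-(α - α')) with hr₁
  set r₂ : ℝ := (2 : ℝ) ^ (-β) with hr₂
  have h10 : 0 < r₁ := by positivity
  have h20 : 0 < r₂ := by positivity
  have h11 : r₁ < 1 := Real.rpow_lt_one_of_one_lt_of_neg (by norm_num) (by linarith)
  have h21 : r₂ < 1 := Real.rpow_lt_one_of_one_lt_of_neg (by norm_num) (by linarith)
  set r := max r₁ r₂ with hr
  have hr0 : 0 ≤ r := h10.le.trans (le_max_left _ _)
  have hr1 : r < 1 := max_lt h11 h21
  set P : ℝ := (2 : ℝ) ^ (-(K * β)) with hP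
  have hP0 : 0 < P := by positivity
  have hK : (0 : ℝ) < K + 1 := by positivity
  refine (ENNReal.tsum_le_ofReal_of_geometric_tail (K := K) (A := P) (B := (C + L) * P) (r := r)
    hP0.le (by positivity) hr0 hr1 ?_ fun m => ?_).trans (le_of_eq (by congr 1; ring))
  -- Each of the `K + 1` levels contributes exactly `P / (K + 1)`; this is why the tolerance carries
  -- the divisor `K + 1`.
  · have e : ∀ l ∈ Finset.range (K + 1),
        ENNReal.ofReal (if l ≤ K then (2 : ℝ) ^ (-(K * β) - (l : ℝ) / 2) / (K + 1)
          else s l * (2 : ℝ) ^ (((l : ℝ) - K) * α') + (2 : ℝ) ^ (-(l : ℝ) * (1 / 2 + β)) * L) *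
        ENNReal.ofReal ((2 : ℝ) ^ ((l : ℝ) / 2)) = ENNReal.ofReal (P / (K + 1)) := by
      intro l hl
      rw [if_pos (Nat.lt_succ_iff.1 (Finset.mem_range.1 hl)), ← ENNReal.ofReal_mul (by positivity),
        div_mul_eq_mul_div, ← Real.rpow_add (by norm_num), sub_add_cancel]
    rw [Finset.sum_congr rfl e, ← ENNReal.ofReal_sum_of_nonneg fun _ _ => by positivity,
      Finset.sum_const, Finset.card_range, nsmul_eq_mul]
    refine ENNReal.ofReal_le_ofReal (le_of_eq ?_)
    push_cast
    field_simp
  · rw [if_neg (by omega), ← ENNReal.ofReal_mul' (by positivity)]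
    refine ENNReal.ofReal_le_ofReal ?_
    push_cast
    have t1 : s (m + (K + 1)) * (2 : ℝ) ^ (((m : ℝ) + (K + 1) - K) * α') *
        (2 : ℝ) ^ (((m : ℝ) + (K + 1)) / 2) ≤ C * P * r ^ m := by
      have h := hC (m + (K + 1))
      push_cast at h
      calc _ ≤ C * (2 : ℝ) ^ (-((m : ℝ) + (K + 1)) * (1 / 2 + α)) *
            (2 : ℝ) ^ (((m : ℝ) + (K + 1) - K) * α') *
            (2 : ℝ) ^ (((m : ℝ) + (K + 1)) / 2) := by gcongr
        _ = C * (2 : ℝ) ^ (-(K * α)) * r₁ ^ (m + 1) := by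
            rw [hr₁, ← Real.rpow_natCast, ← Real.rpow_mul (by norm_num), mul_assoc, mul_assoc,
              ← Real.rpow_add (by norm_num), ← Real.rpow_add (by norm_num), mul_assoc,
              ← Real.rpow_add (by norm_num)]
            congr 2
            push_cast
            ring
        _ ≤ C * P * r ^ m := by
            have a1 : (2 : ℝ) ^ (-(K * α)) ≤ P :=
              Real.rpow_le_rpow_of_exponent_le (by norm_num)
                (neg_le_neg (mul_le_mul_of_nonneg_left hβα (by positivity)))
            have a2 : r₁ ^ (m + 1) ≤ r ^ m :=
              (pow_le_pow_of_le_one h10.le h11.le (Nat.le_succ m)).trans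
                (pow_le_pow_left₀ h10.le (le_max_left _ _) m)
            gcongr
    have t2 : (2 : ℝ) ^ (-((m : ℝ) + (K + 1)) * (1 / 2 + β)) * L *
        (2 : ℝ) ^ (((m : ℝ) + (K + 1)) / 2) ≤ L * P * r ^ m := by
      calc _ = L * P * r₂ ^ (m + 1) := by
            rw [hr₂, ← Real.rpow_natCast, ← Real.rpow_mul (by norm_num), mul_right_comm,
              ← Real.rpow_add (by norm_num), mul_comm, mul_assoc, hP,
              ← Real.rpow_add (by norm_num)]
            congr 2
            push_cast
            ring
        _ ≤ L * P * r ^ m := by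
            have a2 : r₂ ^ (m + 1) ≤ r ^ m :=
              (pow_le_pow_of_le_one h20.le h21.le (Nat.le_succ m)).trans
                (pow_le_pow_left₀ h20.le (le_max_right _ _) m)
            gcongr
    calc _ = s (m + (K + 1)) * (2 : ℝ) ^ (((m : ℝ) + (K + 1) - K) * α') *
          (2 : ℝ) ^ (((m : ℝ) + (K + 1)) / 2) +
          (2 : ℝ) ^ (-((m : ℝ) + (K + 1)) * (1 / 2 + β)) * L *
          (2 : ℝ) ^ (((m : ℝ) + (K + 1)) / 2) := by ring
      _ ≤ C * P * r ^ m + L * P * r ^ m := add_le_add t1 t2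
      _ = _ := by ring

/-- With `2^l` coordinates at level `l`, the block up to `K` costs at most `2Q 2^K`. Beyond it the
cost is `C 2^K 2^{(1-2α')(l-K)}`, geometric precisely because `α' > 1/2`. -/
theorem tsum_exponent_le {α' Q C : ℝ} (hα' : 1 / 2 < α') (hQ : 0 ≤ Q) (hC : 0 ≤ C) (K : ℕ) :
    ∑' l : ℕ, ENNReal.ofReal (if l ≤ K then Q else C / ((2 : ℝ) ^ (((l : ℝ) - K) * α')) ^ 2) *
      2 ^ l ≤ ENNReal.ofReal ((2 * Q + C * (1 - (2 : ℝ) ^ (1 - 2 * α'))⁻¹) * 2 ^ K) := by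
  set r : ℝ := (2 : ℝ) ^ (1 - 2 * α') with hr
  have hr0 : 0 < r := by positivity
  have hr1 : r < 1 := Real.rpow_lt_one_of_one_lt_of_neg (by norm_num) (by linarith)
  have e2 (l : ℕ) : (2 : ℝ≥0∞) ^ l = ENNReal.ofReal (2 ^ l) := by
    rw [ENNReal.ofReal_pow (by norm_num)]; simp
  refine (ENNReal.tsum_le_ofReal_of_geometric_tail (K := K) (A := 2 * Q * 2 ^ K) (B := C * 2 ^ K)
    (r := r) (by positivity) (by positivity) hr0.le hr1 ?_ fun m => ?_).trans
    (le_of_eq (by congr 1; ring))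
  · calc _ = ∑ l ∈ Finset.range (K + 1), ENNReal.ofReal (Q * 2 ^ l) := by
          refine Finset.sum_congr rfl fun l hl => ?_
          rw [if_pos (Nat.lt_succ_iff.1 (Finset.mem_range.1 hl)), e2, ← ENNReal.ofReal_mul hQ]
      _ ≤ _ := by
          rw [← ENNReal.ofReal_sum_of_nonneg fun _ _ => by positivity, ← Finset.mul_sum,
            geom_sum_eq (by norm_num)]
          refine ENNReal.ofReal_le_ofReal ?_
          rw [mul_comm 2 Q, mul_assoc]
          refine mul_le_mul_of_nonneg_left ?_ hQ
          rw [pow_succ]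
          linarith
  · rw [if_neg (by omega), e2, ← ENNReal.ofReal_mul (by positivity)]
    refine ENNReal.ofReal_le_ofReal ?_
    calc _ = C * 2 ^ K * r ^ (m + 1) := by
          rw [hr, ← Real.rpow_natCast _ (m + 1), ← Real.rpow_mul (by norm_num),
            div_mul_eq_mul_div, mul_div_assoc, mul_assoc]
          congr 1
          rw [← Real.rpow_natCast _ 2, ← Real.rpow_mul (by norm_num), ← Real.rpow_natCast _ K,
            ← Real.rpow_natCast _ (m + (K + 1)), ← Real.rpow_sub (by norm_num),
            ← Real.rpow_add (by norm_num)]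
          congr 1
          push_cast
          ring
      _ ≤ _ := by
          have := pow_le_pow_of_le_one hr0.le hr1.le (Nat.le_succ m)
          gcongr

/-- The prior mass of uniform neighbourhoods of a function of the Hölder ball. -/
theorem exists_exp_neg_le_seriesPrior (W : BoundaryWaveletBasis) {κ c₁ c₂ : ℝ} (hκ : 0 ≤ κ)
    (hc₁ : 0 < c₁) (hc₂ : 0 < c₂) (H : HeavyTailedDensity κ c₁ c₂) {s : ℕ → ℝ} {α a β L : ℝ}
    (hs : RegularScale s α a) (hα : 1 / 2 < α) (ha : 1 ≤ a) (hβ : 0 < β) (hβα : β ≤ α)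
    (hL : 0 < L) :
    ∃ C : ℝ, 0 < C ∧ ∀ θ₀ : WaveletIndex W.J → ℝ,
      (∀ i, |θ₀ i| ≤ (2 : ℝ) ^ (-(i.level : ℝ) * (1 / 2 + β)) * L) → ∀ K : ℕ,
      ∃ U : Set (WaveletIndex W.J → ℝ), MeasurableSet U ∧
        ENNReal.ofReal (Real.exp (-(C * 2 ^ K * ((K : ℝ) + 1) ^ (a * (1 + κ))))) ≤
          seriesPrior W H s U ∧
        ∀ θ ∈ U, ∀ x, ∑' i, ‖θ i - θ₀ i‖ₑ * ‖W.fn i x‖ₑ ≤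
          ENNReal.ofReal (C * (2 : ℝ) ^ (-(K * β))) := by
  obtain ⟨Cs, hCs0, hCs⟩ := hs.decay
  obtain ⟨A, hA0, hA⟩ := hs.log_inv_le
  obtain ⟨D, hD0, hD⟩ := W.exists_tsum_mul_fn_le
  obtain ⟨C₂, hC₂0, hC₂⟩ := H.exists_exp_neg_le_law_abs_le hc₂
  -- `α' > 1/2` makes the cost of the high levels summable; `α' < α` keeps their contribution to the
  -- uniform norm summable.
  obtain ⟨α', hα'1, hα'2⟩ := exists_between hα
  set p := a * (1 + κ) with hp
  have hp1 : 1 ≤ p := by nlinarith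
  set A' := Real.log (2 + L) + A with hA'
  have hlogL : 0 ≤ Real.log (2 + L) := Real.log_nonneg (by linarith)
  have hA'0 : 0 ≤ A' := by positivity
  set C₁ := c₁ * (1 + A' ^ (1 + κ)) + (β + 2) with hC₁
  have hC₁0 : 0 < C₁ := by positivity
  set r := (1 - (2 : ℝ) ^ (1 - 2 * α'))⁻¹ with hr
  have hr0 : 0 < r := inv_pos.2 (sub_pos.2
    (Real.rpow_lt_one_of_one_lt_of_neg (by norm_num) (by linarith)))
  set Cd := 1 + (Cs + L) * (1 - max ((2 : ℝ) ^ (-(α - α'))) ((2 : ℝ) ^ (-β)))⁻¹ with hCd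
  set Cm := (2 ^ W.J + 1) * (2 * C₁ + C₂ * r) with hCm
  have hCm0 : 0 < Cm := by positivity
  refine ⟨max Cm (D * Cd), lt_max_of_lt_left hCm0, fun θ₀ hθ₀ K => ?_⟩
  have hK1 : (1 : ℝ) ≤ (K : ℝ) + 1 := by linarith [(Nat.cast_nonneg K : (0 : ℝ) ≤ K)]
  have hKp : 1 ≤ ((K : ℝ) + 1) ^ p := Real.one_le_rpow hK1 (by linarith)
  set δ : ℕ → ℝ := fun l => (2 : ℝ) ^ (-(K * β) - (l : ℝ) / 2) / (K + 1) with hδ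
  set t : ℕ → ℝ := fun l => (2 : ℝ) ^ (((l : ℝ) - K) * α') with ht
  have hδ0 (l) : 0 < δ l := by positivity
  have hδ1 (l) : δ l ≤ 1 := by
    refine div_le_one_of_le₀ (le_trans ?_ hK1) (by positivity)
    refine Real.rpow_le_one_of_one_le_of_nonpos (by norm_num) ?_
    have : 0 ≤ K * β := by positivity
    have : (0 : ℝ) ≤ (l : ℝ) / 2 := by positivity
    linarith
  -- High-level coefficients need not follow their targets: both the draw and the target are small
  -- there, and their sizes are simply added.
  set T : WaveletIndex W.J → Set ℝ := fun i =>
    if i.level ≤ K then {z | |z - θ₀ i| ≤ δ i.level} else {z | |z| ≤ s i.level * t i.level} with hT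
  have hTm (i) : MeasurableSet (T i) := by
    simp only [hT]
    split_ifs
    · exact measurableSet_le (by fun_prop) measurable_const
    · exact measurableSet_le (by fun_prop) measurable_const
  have hUm : MeasurableSet (Set.univ.pi T) := MeasurableSet.univ_pi hTm
  set b : ℕ → ℝ := fun l => if l ≤ K then C₁ * ((K : ℝ) + 1) ^ p else C₂ / t l ^ 2 with hb
  have hb0 (l) : 0 ≤ b l := by
    simp only [hb]
    split_ifs <;> positivity
  have hlog (l : ℕ) (hl : l ≤ K) :
      c₁ * (1 + (Real.log (2 + L) + Real.log (1 / s l)) ^ (1 + κ)) + Real.log (1 / δ l) ≤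
        C₁ * ((K : ℝ) + 1) ^ p := by
    have h1 : Real.log (2 + L) + Real.log (1 / s l) ≤ A' * ((K : ℝ) + 1) ^ a := by
      have h2 : ((l : ℝ) + 1) ^ a ≤ ((K : ℝ) + 1) ^ a :=
        Real.rpow_le_rpow (by positivity) (by exact_mod_cast Nat.succ_le_succ hl) (by linarith)
      have h3 : (1 : ℝ) ≤ ((K : ℝ) + 1) ^ a := Real.one_le_rpow hK1 (by linarith)
      have := hA l
      nlinarith
    have h0 : 0 ≤ Real.log (2 + L) + Real.log (1 / s l) :=
      add_nonneg hlogL (Real.log_nonneg ((one_le_div (hs.pos l)).2 (hs.le_one l)))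
    have h4 : (Real.log (2 + L) + Real.log (1 / s l)) ^ (1 + κ) ≤
        A' ^ (1 + κ) * ((K : ℝ) + 1) ^ p := by
      refine (Real.rpow_le_rpow h0 h1 (by linarith)).trans (le_of_eq ?_)
      rw [Real.mul_rpow hA'0 (by positivity), ← Real.rpow_mul (by positivity)]
    have h5 : (β + 2) * ((K : ℝ) + 1) ≤ (β + 2) * ((K : ℝ) + 1) ^ p :=
      mul_le_mul_of_nonneg_left (by simpa using Real.rpow_le_rpow_of_exponent_le hK1 hp1)
        (by linarith)
    have h6 := log_inv_resolution_le hβ hl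
    have h7 : c₁ * (1 + (Real.log (2 + L) + Real.log (1 / s l)) ^ (1 + κ)) ≤
        c₁ * (((K : ℝ) + 1) ^ p + A' ^ (1 + κ) * ((K : ℝ) + 1) ^ p) := by gcongr
    calc _ ≤ c₁ * (((K : ℝ) + 1) ^ p + A' ^ (1 + κ) * ((K : ℝ) + 1) ^ p) +
          (β + 2) * ((K : ℝ) + 1) ^ p := add_le_add h7 (h6.trans h5)
      _ = _ := by rw [hC₁]; ring
  have hbT (i : WaveletIndex W.J) : ENNReal.ofReal (Real.exp (-b i.level)) ≤
      (H.law.map fun z => s i.level * z) (T i) := by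
    rw [Measure.map_apply (measurable_const_mul _) (hTm i)]
    simp only [hT, hb]
    split_ifs with hl
    · refine le_trans (ENNReal.ofReal_le_ofReal (Real.exp_le_exp.2 (neg_le_neg (hlog _ hl))))
        (H.exp_neg_le_law_scaled_ball hκ hc₁ (hs.pos _) (hs.le_one _) ?_ (hδ0 _) (hδ1 _))
      refine (hθ₀ i).trans (mul_le_of_le_one_left hL.le ?_)
      refine Real.rpow_le_one_of_one_le_of_nonpos (by norm_num) ?_
      have : (0 : ℝ) ≤ i.level * (1 / 2 + β) := by positivity
      linarith
    · refine (hC₂ (t i.level) ?_).trans (measure_mono fun z (hz : |z| ≤ t i.level) => ?_)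
      · refine Real.one_le_rpow (by norm_num) (mul_nonneg ?_ (by linarith))
        rw [sub_nonneg]
        exact_mod_cast (not_le.1 hl).le
      · simp only [Set.preimage_ofPred_eq, Set.mem_ofPred_eq]
        rw [abs_mul, abs_of_pos (hs.pos _)]
        exact mul_le_mul_of_nonneg_left hz (hs.pos _).le
  refine ⟨Set.univ.pi T, hUm, ?_, fun θ hθ x => ?_⟩
  · have (i : WaveletIndex W.J) : IsProbabilityMeasure (H.law.map fun z => s i.level * z) :=
      Measure.isProbabilityMeasure_map (measurable_const_mul _).aemeasurable
    rw [seriesPrior_eq_infinitePi]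
    refine Measure.exp_neg_le_infinitePi_pi _ hTm (fun i => hb0 i.level) hbT (by positivity) ?_
    calc ∑' i : WaveletIndex W.J, ENNReal.ofReal (b i.level)
        ≤ (2 ^ W.J + 1) * ∑' l, ENNReal.ofReal (b l) * 2 ^ l :=
          WaveletIndex.tsum_level_le fun l => ENNReal.ofReal (b l)
      _ ≤ (2 ^ W.J + 1) *
          ENNReal.ofReal ((2 * (C₁ * ((K : ℝ) + 1) ^ p) + C₂ * r) * 2 ^ K) := by
          gcongr
          exact tsum_exponent_le hα'1 (by positivity) hC₂0.le K
      _ = ENNReal.ofReal ((2 ^ W.J + 1) *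
          ((2 * (C₁ * ((K : ℝ) + 1) ^ p) + C₂ * r) * 2 ^ K)) := by
          rw [eq_comm, ENNReal.ofReal_mul (by positivity), eq_comm]
          congr 1
          rw [ENNReal.ofReal_add (by positivity) (by norm_num), ENNReal.ofReal_pow (by norm_num)]
          simp
      _ ≤ _ := by
          refine ENNReal.ofReal_le_ofReal ?_
          calc (2 ^ W.J + 1) * ((2 * (C₁ * ((K : ℝ) + 1) ^ p) + C₂ * r) * 2 ^ K)
              ≤ (2 ^ W.J + 1) *
                ((2 * (C₁ * ((K : ℝ) + 1) ^ p) + C₂ * r * ((K : ℝ) + 1) ^ p) * 2 ^ K) := by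
                have := le_mul_of_one_le_right (mul_pos hC₂0 hr0).le hKp
                gcongr
            _ = Cm * 2 ^ K * ((K : ℝ) + 1) ^ p := by rw [hCm]; ring
            _ ≤ _ := by
                gcongr
                exact le_max_left _ _
  · calc ∑' i, ‖θ i - θ₀ i‖ₑ * ‖W.fn i x‖ₑ
        ≤ ∑' i : WaveletIndex W.J, ENNReal.ofReal (if i.level ≤ K then δ i.level else
            s i.level * t i.level + (2 : ℝ) ^ (-(i.level : ℝ) * (1 / 2 + β)) * L) *
            ‖W.fn i x‖ₑ := by
          refine ENNReal.tsum_le_tsum fun i => ?_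
          gcongr
          rw [Real.enorm_eq_ofReal_abs]
          refine ENNReal.ofReal_le_ofReal ?_
          have h := hθ i (Set.mem_univ i)
          simp only [hT] at h
          split_ifs at h ⊢ with hl
          · exact h
          · exact (abs_sub _ _).trans (add_le_add h (hθ₀ i))
      _ ≤ ENNReal.ofReal D * ENNReal.ofReal (Cd * (2 : ℝ) ^ (-(K * β))) := by
          refine (hD (fun l => ENNReal.ofReal (if l ≤ K then δ l else
            s l * t l + (2 : ℝ) ^ (-(l : ℝ) * (1 / 2 + β)) * L)) x).trans ?_
          gcongr
          exact tsum_deviation_le hα'2 hβ hβα hL.le hCs0 hCs K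
      _ ≤ _ := by
          rw [← ENNReal.ofReal_mul hD0.le, ← mul_assoc]
          refine ENNReal.ofReal_le_ofReal ?_
          gcongr
          exact le_max_right _ _

/-- Borel-Cantelli: the probabilities of `|θ_i| > s_l 2^{lα'}` are at most `2c₂ 2^{-2lα'}`, summable
over the indices as `α' > 1/2`. The surviving bound gives an absolutely convergent series as `α' <
α`. -/
theorem RegularScale.priorWellDefined (W : BoundaryWaveletBasis) {κ c₁ c₂ : ℝ}
    (hc₂ : 0 < c₂) (H : HeavyTailedDensity κ c₁ c₂) {s : ℕ → ℝ} {α a : ℝ}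
    (hs : RegularScale s α a) (hα : 1 / 2 < α) : PriorWellDefined W H s := by
  obtain ⟨Cs, hCs0, hCs⟩ := hs.decay
  obtain ⟨D, hD0, hD⟩ := W.exists_tsum_mul_fn_le
  obtain ⟨α', hα'1, hα'2⟩ := exists_between hα
  set t : ℕ → ℝ := fun l => (2 : ℝ) ^ ((l : ℝ) * α') with ht
  have ht1 (l) : 1 ≤ t l := Real.one_le_rpow (by norm_num) (by positivity)
  have hst (l) : 0 < s l * t l := mul_pos (hs.pos l) (by positivity)
  have hbad (i : WaveletIndex W.J) :
      seriesPrior W H s {θ | θ i ∈ {z : ℝ | s i.level * t i.level < |z|}} ≤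
        ENNReal.ofReal (2 * c₂ / t i.level ^ 2) := by
    rw [seriesPrior_eval W H s i (measurableSet_lt measurable_const measurable_abs)]
    refine le_trans (measure_mono fun z hz => ?_) (H.law_abs_gt_le (ht1 i.level))
    simp only [Set.mem_ofPred_eq, abs_mul, abs_of_pos (hs.pos i.level)] at hz ⊢
    exact lt_of_mul_lt_mul_left hz (hs.pos _).le
  have hsum : ∑' i : WaveletIndex W.J,
      seriesPrior W H s {θ | θ i ∈ {z : ℝ | s i.level * t i.level < |z|}} ≠ ∞ := by
    refine ne_top_of_le_ne_top ?_ ((ENNReal.tsum_le_tsum hbad).trans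
      (WaveletIndex.tsum_level_le fun l => ENNReal.ofReal (2 * c₂ / t l ^ 2)))
    have h := tsum_exponent_le hα'1 (Q := 2 * c₂) (C := 2 * c₂) (by positivity) (by positivity) 0
    refine ENNReal.mul_ne_top (by simp) (ne_top_of_le_ne_top ENNReal.ofReal_ne_top
      (le_trans (ENNReal.tsum_le_tsum fun l => ?_) h))
    gcongr
    split_ifs with hl
    · exact div_le_self (by positivity) (one_le_pow₀ (ht1 l))
    · simp [ht]
  filter_upwards [ae_finite_setOfPred_mem hsum] with θ hθ
  -- The finitely many exceptional coefficients are absorbed into the constant.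
  obtain ⟨R, hR0, hR⟩ : ∃ R : ℝ, 0 ≤ R ∧
      ∀ i : WaveletIndex W.J, |θ i| ≤ R * (s i.level * t i.level) := by
    set S := hθ.toFinset
    refine ⟨1 + ∑ i ∈ S, |θ i| / (s i.level * t i.level),
      add_nonneg zero_le_one (Finset.sum_nonneg fun i _ => div_nonneg (abs_nonneg _) (hst _).le),
      fun i => ?_⟩
    rw [← div_le_iff₀ (hst _)]
    have hnn : ∀ i ∈ S, 0 ≤ |θ i| / (s i.level * t i.level) :=
      fun i _ => div_nonneg (abs_nonneg _) (hst _).le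
    by_cases hi : i ∈ S
    · have := Finset.single_le_sum hnn hi
      linarith
    · have h1 : |θ i| ≤ s i.level * t i.level := by
        simpa [S] using hi
      have h2 := (div_le_one (hst _)).2 h1
      have := Finset.sum_nonneg hnn
      linarith
  have hbound : ∃ B : ℝ, ∀ x, ∑' i, ‖θ i‖ₑ * ‖W.fn i x‖ₑ ≤ ENNReal.ofReal B := by
    set r : ℝ := (2 : ℝ) ^ (-(α - α')) with hr
    have hr0 : 0 < r := by positivity
    have hr1 : r < 1 := Real.rpow_lt_one_of_one_lt_of_neg (by norm_num) (by linarith)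
    refine ⟨D * (R * Cs * (1 - r)⁻¹), fun x => ?_⟩
    calc ∑' i, ‖θ i‖ₑ * ‖W.fn i x‖ₑ
        ≤ ∑' i : WaveletIndex W.J,
            ENNReal.ofReal (R * (s i.level * t i.level)) * ‖W.fn i x‖ₑ := by
          refine ENNReal.tsum_le_tsum fun i => ?_
          gcongr
          rw [Real.enorm_eq_ofReal_abs]
          exact ENNReal.ofReal_le_ofReal (hR i)
      _ ≤ ENNReal.ofReal D * ENNReal.ofReal (R * Cs * (1 - r)⁻¹) := by
          refine (hD (fun l => ENNReal.ofReal (R * (s l * t l))) x).trans ?_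
          gcongr
          rw [← tsum_geometric_of_lt_one hr0.le hr1, ← tsum_mul_left, ENNReal.ofReal_tsum_of_nonneg
            (fun n => by positivity) ((summable_geometric_of_lt_one hr0.le hr1).mul_left _)]
          refine ENNReal.tsum_le_tsum fun l => ?_
          rw [← ENNReal.ofReal_mul' (by positivity)]
          refine ENNReal.ofReal_le_ofReal ?_
          calc R * (s l * t l) * (2 : ℝ) ^ ((l : ℝ) / 2)
              ≤ R * (Cs * (2 : ℝ) ^ (-(l : ℝ) * (1 / 2 + α)) * t l) * (2 : ℝ) ^ ((l : ℝ) / 2) := by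
                gcongr
                exact hCs l
            _ = R * Cs * r ^ l := by
                rw [hr, ← Real.rpow_natCast, ← Real.rpow_mul (by norm_num), ht, mul_assoc Cs,
                  ← Real.rpow_add (by norm_num), mul_assoc, mul_assoc Cs,
                  ← Real.rpow_add (by norm_num), mul_assoc]
                congr 3
                ring
      _ = _ := (ENNReal.ofReal_mul hD0.le).symm
  obtain ⟨B, hB⟩ := hbound
  refine ⟨fun x => W.summable_of_tsum_enorm_ne_top
    (ne_top_of_le_ne_top ENNReal.ofReal_ne_top (hB x)), max B 0, fun x => ?_⟩
  have h : ‖W.series θ x‖ₑ ≤ ENNReal.ofReal (max B 0) := by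
    refine (enorm_tsum_le_tsum_enorm).trans ?_
    simp_rw [enorm_mul]
    exact (hB x).trans (ENNReal.ofReal_le_ofReal (le_max_left _ _))
  rwa [Real.enorm_eq_ofReal_abs, ENNReal.ofReal_le_ofReal_iff (le_max_right _ _)] at h

/-! ### Contraction of the tempered posterior of a series prior -/

theorem integrable_exp_of_ae_abs_sub_le {f f₀ : unitInterval → ℝ} (hf : Measurable f)
    (hi : Integrable (fun x => Real.exp (f₀ x)) volume) {η : ℝ}
    (hdist : ∀ᵐ x, |f x - f₀ x| ≤ η) : Integrable (fun x => Real.exp (f x)) volume := by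
  refine (hi.const_mul (Real.exp η)).mono' (Real.measurable_exp.comp hf).aestronglyMeasurable ?_
  filter_upwards [hdist] with x hx
  rw [Real.norm_eq_abs, Real.abs_exp, ← Real.exp_add, Real.exp_le_exp]
  linarith [(abs_le.1 hx).2]

theorem BoundaryWaveletBasis.measurable_uncurry_expDensity_series (W : BoundaryWaveletBasis) :
    Measurable (Function.uncurry fun (θ : WaveletIndex W.J → ℝ) x =>
      expDensity (W.series θ) x) := by
  have h : Measurable (Function.uncurry fun (θ : WaveletIndex W.J → ℝ) x =>
      Real.exp (W.series θ x)) := Real.measurable_exp.comp W.measurable_uncurry_series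
  have hZ : Measurable fun θ : WaveletIndex W.J → ℝ => ∫ u, Real.exp (W.series θ u) :=
    h.stronglyMeasurable.integral_prod_right.measurable
  exact h.div (hZ.comp measurable_fst)

theorem BoundaryWaveletBasis.abs_series_sub_le (W : BoundaryWaveletBasis)
    {θ θ₀ : WaveletIndex W.J → ℝ} {x : unitInterval} {η : ℝ} (hη : 0 ≤ η)
    (h₀ : Summable fun i => θ₀ i * W.fn i x)
    (h : ∑' i, ‖θ i - θ₀ i‖ₑ * ‖W.fn i x‖ₑ ≤ ENNReal.ofReal η) :
    |W.series θ x - W.series θ₀ x| ≤ η := by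
  have hd : Summable fun i => (θ i - θ₀ i) * W.fn i x :=
    W.summable_of_tsum_enorm_ne_top (θ := fun i => θ i - θ₀ i)
      (ne_top_of_le_ne_top ENNReal.ofReal_ne_top h)
  have e : W.series θ x - W.series θ₀ x = ∑' i, (θ i - θ₀ i) * W.fn i x := by
    have hθ : Summable fun i => θ i * W.fn i x := (hd.add h₀).congr fun i => by ring
    rw [series, series, ← hθ.tsum_sub h₀]
    exact tsum_congr fun i => by ring
  rw [e, ← ENNReal.ofReal_le_ofReal_iff hη, ← Real.enorm_eq_ofReal_abs]
  refine enorm_tsum_le_tsum_enorm.trans ?_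
  simpa only [enorm_mul] using h

theorem expectedPosteriorMass_le (W : BoundaryWaveletBasis) {κ c₁ c₂ : ℝ}
    (H : HeavyTailedDensity κ c₁ c₂) {s : ℕ → ℝ} (hW : PriorWellDefined W H s) {ρ : ℝ}
    (hρ0 : 0 < ρ) (hρ1 : ρ < 1) {β L : ℝ} (hβ : 0 < β) {g₀ : unitInterval → ℝ}
    (hg₀ : IsDensityAwayFromZero g₀) (hball : (fun x => Real.log (g₀ x)) ∈ W.holderBall β L)
    {U : Set (WaveletIndex W.J → ℝ)} (hU : MeasurableSet U) {η : ℝ} (hη0 : 0 ≤ η) (hη1 : η ≤ 1)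
    (hUη : ∀ θ ∈ U, ∀ x,
      ∑' i, ‖θ i - W.coeff (fun x => Real.log (g₀ x)) i‖ₑ * ‖W.fn i x‖ₑ ≤ ENNReal.ofReal η)
    {b : ℝ} (hb : 0 ≤ b) (hUb : ENNReal.ofReal (Real.exp (-b)) ≤ seriesPrior W H s U)
    {d : ℝ} (hd : 0 ≤ d) (n : ℕ) :
    expectedPosteriorMass W H s ρ g₀ n d ≤
      2 * ENNReal.ofReal (Real.exp (b + 2 * η ^ 2 * n - min ρ (1 - ρ) / 8 * d ^ 2 * n)) := by
  set f₀ : unitInterval → ℝ := fun x => Real.log (g₀ x) with hf₀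
  have hf₀m : Measurable f₀ := Real.measurable_log.comp hg₀.measurable
  obtain ⟨c, hc0, hc⟩ := hg₀.bounded_below
  -- `g₀` is positive only almost everywhere; the version `exp (f₀ x)` is positive everywhere, as
  -- the general bound requires.
  have hge : ∀ᵐ x, g₀ x = Real.exp (f₀ x) := by
    filter_upwards [hc] with x hx
    exact (Real.exp_log (hc0.trans_le hx)).symm
  have hi₀ : Integrable (fun x => Real.exp (f₀ x)) volume := by
    refine Integrable.congr ?_ hge
    by_contra h
    have := hg₀.integral_eq_one
    rw [integral_undef h] at this
    exact zero_ne_one this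
  have h1 : ∫ x, Real.exp (f₀ x) = 1 := by
    rw [← hg₀.integral_eq_one]
    exact (integral_congr_ae hge).symm
  have hem : Measurable fun x => Real.exp (f₀ x) := Real.measurable_exp.comp hf₀m
  have hlaw : densityLaw g₀ = densityLaw fun x => Real.exp (f₀ x) :=
    withDensity_congr_ae (hge.mono fun x hx => by simp only [hx])
  have hprob : IsProbabilityMeasure (densityLaw fun x => Real.exp (f₀ x)) := by
    refine ⟨?_⟩
    rw [densityLaw, withDensity_apply _ MeasurableSet.univ, Measure.restrict_univ,
      ← ofReal_integral_eq_lintegral_ofReal hi₀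
        (Eventually.of_forall fun x => (Real.exp_pos _).le), h1, ENNReal.ofReal_one]
  have hset : {θ : WaveletIndex W.J → ℝ | ENNReal.ofReal d <
      eLpNorm (fun x => expDensity (W.series θ) x - g₀ x) 1 volume} =
      {θ | ENNReal.ofReal d <
        ∫⁻ x, ENNReal.ofReal |expDensity (W.series θ) x - Real.exp (f₀ x)|} := by
    ext θ
    simp only [Set.mem_ofPred_eq]
    rw [eLpNorm_one_eq_lintegral_enorm]
    simp_rw [Real.enorm_eq_ofReal_abs]
    rw [lintegral_congr_ae (g := fun x =>
      ENNReal.ofReal |expDensity (W.series θ) x - Real.exp (f₀ x)|)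
      (hge.mono fun x hx => by simp only [hx])]
  have hqm := W.measurable_uncurry_expDensity_series
  have hsm (θ) : Measurable (W.series θ) := W.measurable_uncurry_series.of_uncurry_left
  have hdm (θ) : Measurable (expDensity (W.series θ)) :=
    (Real.measurable_exp.comp (hsm θ)).div_const _
  have hAm : MeasurableSet {θ : WaveletIndex W.J → ℝ | ENNReal.ofReal d <
      ∫⁻ x, ENNReal.ofReal |expDensity (W.series θ) x - Real.exp (f₀ x)|} := by
    refine measurableSet_lt measurable_const ?_
    have h : Measurable (Function.uncurry fun (θ : WaveletIndex W.J → ℝ) x =>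
        ENNReal.ofReal |expDensity (W.series θ) x - Real.exp (f₀ x)|) :=
      (measurable_abs.comp (hqm.sub (hem.comp measurable_snd))).ennreal_ofReal
    exact h.lintegral_prod_right
  obtain ⟨hsum₀, hser₀⟩ := W.series_coeff_ae_eq hβ hball
  have hclose (θ) (hθ : θ ∈ U) : ∀ᵐ x, |W.series θ x - f₀ x| ≤ η := by
    filter_upwards [hser₀] with x hx
    rw [← hx]
    exact W.abs_series_sub_le hη0 (hsum₀ x) (hUη θ hθ x)
  have hpos (θ) (hθ : θ ∈ U) (x) : 0 < expDensity (W.series θ) x :=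
    div_pos (Real.exp_pos _)
      (integral_exp_pos (integrable_exp_of_ae_abs_sub_le (hsm θ) hi₀ (hclose θ hθ)))
  set e := min ρ (1 - ρ) / 4 * d ^ 2 with he
  have hmain := lintegral_temperedPosterior_le (seriesPrior W H s)
    (densityLaw fun x => Real.exp (f₀ x)) hρ0
    (q := fun θ x => ENNReal.ofReal (expDensity (W.series θ) x)) hqm.ennreal_ofReal
    (q₀ := fun x => ENNReal.ofReal (Real.exp (f₀ x))) hem.ennreal_ofReal
    (fun x => by simp [Real.exp_pos]) (fun x => ENNReal.ofReal_ne_top)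
    (A := {θ : WaveletIndex W.J → ℝ | ENNReal.ofReal d <
      ∫⁻ x, ENNReal.ofReal |expDensity (W.series θ) x - Real.exp (f₀ x)|})
    hU (a := ENNReal.ofReal (Real.exp (-e))) (b := ENNReal.ofReal (Real.exp (2 * η ^ 2)))
    -- This `t` shares the affinity gain `e n` equally between the two terms, which turns `1/4` into
    -- `1/8` in the exponent.
    (t := ENNReal.ofReal (Real.exp (e * n / 2))) ?_
    (fun θ hθ => lintegral_inv_affinity_le hρ0.le hρ1.le (hsm θ) hf₀m hi₀ h1 hη1 (hclose θ hθ))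
    (fun θ hθ x => by simpa using hpos θ hθ x) (fun θ hθ x => ENNReal.ofReal_ne_top)
    (fun h => by rw [h] at hUb; simp [Real.exp_pos, not_le.2] at hUb)
    (by simp [Real.exp_pos]) ENNReal.ofReal_ne_top n
  · rw [expectedPosteriorMass, hlaw, hset]
    refine hmain.trans ?_
    have hexp : ENNReal.ofReal (Real.exp (e * n / 2)) * ENNReal.ofReal (Real.exp (-e)) ^ n ≤
        ENNReal.ofReal (Real.exp (b + 2 * η ^ 2 * n - e * n / 2)) := by
      rw [← ENNReal.ofReal_pow (Real.exp_pos _).le, ← ENNReal.ofReal_mul (Real.exp_pos _).le,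
        ← Real.exp_nat_mul, ← Real.exp_add]
      refine ENNReal.ofReal_le_ofReal (Real.exp_le_exp.2 ?_)
      have : 0 ≤ 2 * η ^ 2 * n := by positivity
      linarith
    have hexp' : (ENNReal.ofReal (Real.exp (e * n / 2)))⁻¹ *
        ((seriesPrior W H s U)⁻¹ * ENNReal.ofReal (Real.exp (2 * η ^ 2)) ^ n) ≤
        ENNReal.ofReal (Real.exp (b + 2 * η ^ 2 * n - e * n / 2)) := by
      have h : (seriesPrior W H s U)⁻¹ ≤ ENNReal.ofReal (Real.exp b) := by
        rw [ENNReal.inv_le_iff_inv_le, ← ENNReal.ofReal_inv_of_pos (Real.exp_pos _),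
          ← Real.exp_neg]
        exact hUb
      calc _ ≤ (ENNReal.ofReal (Real.exp (e * n / 2)))⁻¹ *
            (ENNReal.ofReal (Real.exp b) * ENNReal.ofReal (Real.exp (2 * η ^ 2)) ^ n) := by gcongr
        _ = _ := by
            rw [← ENNReal.ofReal_pow (Real.exp_pos _).le, ← ENNReal.ofReal_mul (Real.exp_pos _).le,
              ← ENNReal.ofReal_inv_of_pos (Real.exp_pos _),
              ← ENNReal.ofReal_mul (inv_nonneg.2 (Real.exp_pos _).le),
              ← Real.exp_nat_mul, ← Real.exp_add, ← Real.exp_neg, ← Real.exp_add]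
            congr 2
            ring
    have e2 : b + 2 * η ^ 2 * n - e * n / 2 =
        b + 2 * η ^ 2 * n - min ρ (1 - ρ) / 8 * d ^ 2 * n := by rw [he]; ring
    rw [← e2, two_mul (ENNReal.ofReal _)]
    exact add_le_add hexp hexp'
  · rw [ae_restrict_iff' hAm]
    filter_upwards [hW] with θ hθ hθA
    obtain ⟨-, C, hC⟩ := hθ
    have ie : Integrable (fun x => Real.exp (W.series θ x)) volume :=
      integrable_exp_of_ae_abs_sub_le (f₀ := fun _ => 0) (hsm θ) (integrable_const _) (η := C)
        (Eventually.of_forall fun x => by simpa using hC x)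
    have hZ := integral_exp_pos ie
    have ig : Integrable (expDensity (W.series θ)) volume := ie.div_const _
    have hdist : d ≤ ∫ x, |expDensity (W.series θ) x - Real.exp (f₀ x)| := by
      have hθA' : ENNReal.ofReal d <
        ∫⁻ x, ENNReal.ofReal |expDensity (W.series θ) x - Real.exp (f₀ x)| := hθA
      have iabs : Integrable (fun x => |expDensity (W.series θ) x - Real.exp (f₀ x)|) volume :=
        (ig.sub hi₀).abs
      rw [← ofReal_integral_eq_lintegral_ofReal iabs
        (Eventually.of_forall fun x => abs_nonneg _)] at hθA'
      exact (ENNReal.ofReal_le_ofReal_iff (integral_nonneg fun x => abs_nonneg _)).1 hθA'.le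
    refine lintegral_affinity_le volume hρ0.le hρ1.le (hdm θ) hem ig hi₀
      (fun x => (div_pos (Real.exp_pos _) hZ).le) (fun x => Real.exp_pos _) ?_ h1 hd hdist
    simp only [expDensity]
    rw [integral_div, div_self hZ.ne']

/-! ### Rates -/

/-- The inverse of the resolution at which bias and prior mass are balanced. -/
def balancedResolution (p β : ℝ) (n : ℕ) : ℝ :=
  ((n : ℝ) / Real.log n ^ p) ^ (1 / (1 + 2 * β))

theorem tendsto_log_natCast_atTop : Tendsto (fun n : ℕ => Real.log n) atTop atTop :=
  Real.tendsto_log_atTop.comp tendsto_natCast_atTop_atTop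

theorem tendsto_balancedResolution {p β : ℝ} (hβ : 0 < β) :
    Tendsto (balancedResolution p β) atTop atTop := by
  refine (tendsto_rpow_atTop (by positivity : 0 < 1 / (1 + 2 * β))).comp ?_
  have h := ((isLittleO_log_rpow_rpow_atTop p one_pos).tendsto_div_nhds_zero).comp
    (tendsto_natCast_atTop_atTop (R := ℝ))
  have hpos : ∀ᶠ n : ℕ in atTop, 0 < Real.log n ^ p / (n : ℝ) ^ (1 : ℝ) := by
    filter_upwards [tendsto_log_natCast_atTop.eventually_ge_atTop 1, eventually_ge_atTop 1]
      with n h1 h2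
    have : (0 : ℝ) < n := by exact_mod_cast h2
    positivity
  have h2 := (tendsto_inv_nhdsGT_zero.comp
    (tendsto_nhdsWithin_iff.2 ⟨h, hpos⟩))
  refine h2.congr fun n => ?_
  simp

/-- A crude bound, needed only to see that the cut-off level is `O(log n)`. -/
theorem eventually_balancedResolution_le {p β : ℝ} (hp : 0 ≤ p) (hβ : 0 < β) :
    ∀ᶠ n : ℕ in atTop, balancedResolution p β n ≤ n := by
  filter_upwards [tendsto_log_natCast_atTop.eventually_ge_atTop 1, eventually_ge_atTop 1]
    with n h1 h2
  have hn : (1 : ℝ) ≤ n := by exact_mod_cast h2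
  have hl : 1 ≤ Real.log n ^ p := Real.one_le_rpow h1 hp
  calc balancedResolution p β n ≤ (n : ℝ) ^ (1 / (1 + 2 * β)) :=
        Real.rpow_le_rpow (by positivity) (div_le_self (by positivity) hl) (by positivity)
    _ ≤ (n : ℝ) ^ (1 : ℝ) := Real.rpow_le_rpow_of_exponent_le hn
        (div_le_one_of_le₀ (by linarith) (by positivity))
    _ = n := Real.rpow_one _

theorem balancedResolution_rpow_neg {p β : ℝ} (hβ : 0 < β) {n : ℕ} (hn : 1 ≤ Real.log n) :
    balancedResolution p β n ^ (-β) =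
      Real.log n ^ (p * β / (1 + 2 * β)) * (n : ℝ) ^ (-(β / (2 * β + 1))) := by
  have hl : 0 < Real.log n := by linarith
  rw [balancedResolution, ← Real.rpow_mul (by positivity), Real.div_rpow (by positivity)
    (by positivity), ← Real.rpow_mul hl.le, div_eq_mul_inv, ← Real.rpow_neg hl.le, mul_comm]
  have : 1 + 2 * β ≠ 0 := by positivity
  congr 2
  · field_simp
  · rw [add_comm (2 * β)]; field_simp

/-- The balance equation: `T^{1+2β} = n / (log n)^p` equates the approximation cost `n T^{-2β}` with
the prior mass exponent `T (log n)^p`. -/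
theorem natCast_mul_sq_balancedResolution {p β : ℝ} (hβ : 0 < β) {n : ℕ} (hn : 1 ≤ Real.log n) :
    n * (balancedResolution p β n ^ (-β)) ^ 2 = balancedResolution p β n * Real.log n ^ p := by
  have hl : 0 < Real.log n := by linarith
  have hn0 : (0 : ℝ) < n := by
    rcases Nat.eq_zero_or_pos n with h | h
    · rw [h] at hl; simp at hl
    · exact_mod_cast h
  set T := balancedResolution p β n with hT
  have hT0 : 0 < T := by rw [hT, balancedResolution]; positivity
  have h : T ^ (1 + 2 * β) = n / Real.log n ^ p := by
    rw [hT, balancedResolution, ← Real.rpow_mul (by positivity),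
      one_div_mul_cancel (by positivity), Real.rpow_one]
  have h' : (n : ℝ) = T ^ (1 + 2 * β) * Real.log n ^ p := by
    rw [h, div_mul_cancel₀ _ (by positivity)]
  calc n * (T ^ (-β)) ^ 2 = T ^ (1 + 2 * β) * Real.log n ^ p * (T ^ (-β)) ^ 2 := by rw [← h']
    _ = T ^ (1 + 2 * β) * (T ^ (-β)) ^ (2 : ℝ) * Real.log n ^ p := by
        rw [Real.rpow_two]; ring
    _ = T * Real.log n ^ p := by
        rw [← Real.rpow_mul hT0.le, ← Real.rpow_add hT0]
        congr 1
        ring_nf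
        exact Real.rpow_one T

theorem exists_resolution {T : ℝ} (hT : 1 ≤ T) : ∃ K : ℕ, (2 : ℝ) ^ K ≤ T ∧ T ≤ 2 ^ (K + 1) := by
  have hm : ⌊T⌋₊ ≠ 0 := (Nat.floor_pos.2 hT).ne'
  refine ⟨Nat.log 2 ⌊T⌋₊, ?_, ?_⟩
  · calc (2 : ℝ) ^ Nat.log 2 ⌊T⌋₊ ≤ ⌊T⌋₊ := by exact_mod_cast Nat.pow_log_le_self 2 hm
      _ ≤ T := Nat.floor_le (by linarith)
  · calc T ≤ ⌊T⌋₊ + 1 := (Nat.lt_floor_add_one T).le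
      _ ≤ 2 ^ (Nat.log 2 ⌊T⌋₊ + 1) := by
        exact_mod_cast Nat.lt_pow_succ_log_self (by norm_num) ⌊T⌋₊

/-- Contraction at every rate that is eventually at least a fixed multiple of
`(log n)^{pβ/(1+2β)} n^{-β/(1+2β)}`, where `p = a (1 + κ)`. -/
theorem RegularScale.exists_contraction_constant (W : BoundaryWaveletBasis) {κ c₁ c₂ : ℝ}
    (hκ : 0 ≤ κ) (hc₁ : 0 < c₁) (hc₂ : 0 < c₂) (H : HeavyTailedDensity κ c₁ c₂) {s : ℕ → ℝ}
    {α a β L : ℝ} (hs : RegularScale s α a) (hα : 1 / 2 < α) (ha : 1 ≤ a) (hβ : 0 < β)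
    (hβα : β ≤ α) (hL : 0 < L) {ρ : ℝ} (hρ0 : 0 < ρ) (hρ1 : ρ < 1) :
    ∃ M : ℝ, 0 < M ∧ ∀ g₀ : unitInterval → ℝ, IsDensityAwayFromZero g₀ →
      (fun x => Real.log (g₀ x)) ∈ W.holderBall β L → ∀ r : ℕ → ℝ,
      (∀ᶠ n : ℕ in atTop, M * (Real.log n ^ (a * (1 + κ) * β / (1 + 2 * β)) *
        (n : ℝ) ^ (-(β / (2 * β + 1)))) ≤ r n) →
      Tendsto (fun n : ℕ => expectedPosteriorMass W H s ρ g₀ n (r n)) atTop (𝓝 0) := by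
  obtain ⟨C, hC0, hC⟩ := exists_exp_neg_le_seriesPrior W hκ hc₁ hc₂ H hs hα ha hβ hβα hL
  set p := a * (1 + κ) with hp
  have hp1 : 1 ≤ p := by nlinarith
  have hm : 0 < min ρ (1 - ρ) := lt_min hρ0 (by linarith)
  set c := min ρ (1 - ρ) / 8 with hc
  have hc0 : 0 < c := by positivity
  -- In units of `T (log n)^p`, the first term is the prior mass exponent and the second is `2nη²`.
  -- The `3` comes from `K + 1 ≤ 3 log n`, the `2 ^ β` from rounding `T` down to a power of two.
  set E := C * 3 ^ p + 2 * (C * 2 ^ β) ^ 2 with hE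
  have hE0 : 0 < E := by positivity
  -- Chosen so that `c r² n` exceeds the two costs by another `T (log n)^p`, leaving a bound `2 exp
  -- (-T)`.
  refine ⟨√((1 + E) / c), by positivity, fun g₀ hg₀ hball r hr => ?_⟩
  set T := balancedResolution p β with hT
  have hTtop : Tendsto T atTop atTop := tendsto_balancedResolution hβ
  have hbound : ∀ᶠ n : ℕ in atTop, expectedPosteriorMass W H s ρ g₀ n (r n) ≤
      2 * ENNReal.ofReal (Real.exp (-T n)) := by
    have hsmall : ∀ᶠ n : ℕ in atTop, C * 2 ^ β * T n ^ (-β) ≤ 1 := by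
      have := ((tendsto_rpow_neg_atTop hβ).comp hTtop).const_mul (C * 2 ^ β)
      rw [mul_zero] at this
      exact (this.eventually_lt_const one_pos).mono fun n hn => hn.le
    filter_upwards [hr, hsmall, hTtop.eventually_ge_atTop 1,
      tendsto_log_natCast_atTop.eventually_ge_atTop 1,
      eventually_balancedResolution_le (p := p) (by linarith) hβ] with n hrn hη1 hT1 hlog hTn
    obtain ⟨K, hK1, hK2⟩ := exists_resolution hT1
    obtain ⟨U, hUm, hUb, hUη⟩ := hC _ hball.2 K
    have hT0 : 0 < T n := by linarith
    have hη : C * (2 : ℝ) ^ (-(K * β)) ≤ C * 2 ^ β * T n ^ (-β) := by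
      have h : (2 : ℝ) ^ (-(K * β)) = 2 ^ β * ((2 : ℝ) ^ (K + 1)) ^ (-β) := by
        rw [← Real.rpow_natCast, ← Real.rpow_mul (by norm_num), ← Real.rpow_add (by norm_num)]
        congr 1
        push_cast
        ring
      rw [h, mul_assoc]
      have := Real.rpow_le_rpow_of_nonpos hT0 hK2 (neg_nonpos.2 hβ.le)
      gcongr
    have hKlog : (K : ℝ) + 1 ≤ 3 * Real.log n := by
      have h1 : (K : ℝ) * Real.log 2 ≤ Real.log n := by
        rw [← Real.log_pow]
        exact Real.log_le_log (by positivity) (hK1.trans hTn)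
      have h2 := Real.log_two_gt_d9
      nlinarith [(Nat.cast_nonneg K : (0 : ℝ) ≤ K)]
    rw [← balancedResolution_rpow_neg hβ hlog] at hrn
    have hkey := natCast_mul_sq_balancedResolution (p := p) hβ hlog
    set e := T n ^ (-β) with he
    have he0 : 0 ≤ e := by positivity
    set Q := T n * Real.log n ^ p with hQ
    have hTQ : T n ≤ Q := le_mul_of_one_le_right hT0.le (Real.one_le_rpow hlog (by linarith))
    have hrn0 : 0 ≤ r n := le_trans (by positivity) hrn
    refine (expectedPosteriorMass_le W H (hs.priorWellDefined W hc₂ H hα) hρ0 hρ1 hβ hg₀ hball hUm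
      (by positivity) (hη.trans hη1) hUη (by positivity) hUb hrn0 n).trans ?_
    refine mul_le_mul_right (ENNReal.ofReal_le_ofReal (Real.exp_le_exp.2 ?_)) _
    have b1 : C * 2 ^ K * ((K : ℝ) + 1) ^ p ≤ C * 3 ^ p * Q := by
      calc C * 2 ^ K * ((K : ℝ) + 1) ^ p ≤ C * T n * (3 * Real.log n) ^ p := by gcongr
        _ = C * 3 ^ p * Q := by
            rw [Real.mul_rpow (by norm_num) (by linarith), hQ]
            ring
    have b2 : 2 * (C * (2 : ℝ) ^ (-(K * β))) ^ 2 * n ≤ 2 * (C * 2 ^ β) ^ 2 * Q := by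
      calc 2 * (C * (2 : ℝ) ^ (-(K * β))) ^ 2 * n ≤ 2 * (C * 2 ^ β * e) ^ 2 * n := by gcongr
        _ = 2 * (C * 2 ^ β) ^ 2 * (n * e ^ 2) := by ring
        _ = _ := by rw [hkey]
    have b3 : (1 + E) * Q ≤ c * r n ^ 2 * n := by
      calc (1 + E) * Q = c * (√((1 + E) / c) * e) ^ 2 * n := by
            rw [mul_pow, Real.sq_sqrt (by positivity), ← hkey]
            field_simp
        _ ≤ c * r n ^ 2 * n := by gcongr
    refine (sub_le_sub (add_le_add b1 b2) b3).trans (le_of_eq_of_le ?_ (neg_le_neg hTQ))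
    rw [hE]
    ring
  refine tendsto_of_tendsto_of_tendsto_of_le_of_le' tendsto_const_nhds ?_
    (Eventually.of_forall fun _ => zero_le) hbound
  have h : Tendsto (fun n => ENNReal.ofReal (Real.exp (-T n))) atTop (𝓝 0) := by
    have := ENNReal.tendsto_ofReal (Real.tendsto_exp_neg_atTop_nhds_zero.comp hTtop)
    simpa using this
  simpa using ENNReal.Tendsto.const_mul h (Or.inr ENNReal.ofNat_ne_top)

/-! ### The two families of scales and their rates. -/

theorem regularScale_htScale {α : ℝ} (hα : 0 ≤ α) : RegularScale (htScale α) α 1 where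
  pos l := by unfold htScale; positivity
  le_one l := by
    refine Real.rpow_le_one_of_one_le_of_nonpos (by norm_num) ?_
    have : 0 ≤ (l : ℝ) * (1 / 2 + α) := by positivity
    linarith
  decay := ⟨1, zero_le_one, fun l => by rw [one_mul, htScale]⟩
  log_inv_le := by
    refine ⟨1 / 2 + α, by positivity, fun l => ?_⟩
    rw [one_div (htScale α l), Real.log_inv, htScale, Real.log_rpow (by norm_num), Real.rpow_one]
    have h1 : Real.log 2 ≤ 1 := by linarith [Real.log_two_lt_d9]
    have h2 : (l : ℝ) * (1 / 2 + α) * Real.log 2 ≤ (l : ℝ) * (1 / 2 + α) * 1 :=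
      mul_le_mul_of_nonneg_left h1 (by positivity)
    linarith

/-- `2^{-l²}` beats every geometric decay, so `α` is arbitrary; the price is a quadratic `log
(1/s_l)`, which doubles the power of the logarithm. -/
theorem regularScale_otScale (α : ℝ) : RegularScale otScale α 2 where
  pos l := by unfold otScale; positivity
  le_one l := by
    refine Real.rpow_le_one_of_one_le_of_nonpos (by norm_num) ?_
    have : 0 ≤ (l : ℝ) ^ 2 := by positivity
    linarith
  decay := by
    -- With `x = 1/2 + α`, the claim on exponents is `l² - l x + x² ≥ 0`.
    refine ⟨(2 : ℝ) ^ ((1 / 2 + α) ^ 2), by positivity, fun l => ?_⟩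
    rw [otScale, ← Real.rpow_add (by norm_num)]
    refine Real.rpow_le_rpow_of_exponent_le (by norm_num) ?_
    nlinarith [sq_nonneg ((l : ℝ) - (1 / 2 + α)), sq_nonneg ((l : ℝ) + (1 / 2 + α)),
      sq_nonneg (l : ℝ), sq_nonneg (1 / 2 + α)]
  log_inv_le := by
    refine ⟨1, zero_le_one, fun l => ?_⟩
    rw [one_div (otScale l), Real.log_inv, otScale, Real.log_rpow (by norm_num), Real.rpow_two]
    have h1 : Real.log 2 ≤ 1 := by linarith [Real.log_two_lt_d9]
    have h2 : (l : ℝ) ^ 2 * Real.log 2 ≤ (l : ℝ) ^ 2 * 1 :=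
      mul_le_mul_of_nonneg_left h1 (by positivity)
    nlinarith [(Nat.cast_nonneg l : (0 : ℝ) ≤ l)]

/-- The argument yields a rate smaller by the factor `(log log n)^{2/(1+2β)} (log n)^{1/(1+2β)}`,
which is eventually at least `1`. -/
theorem eventually_le_htRate (κ : ℝ) {β : ℝ} (hβ : 0 < β) : ∀ᶠ n : ℕ in atTop,
    Real.log n ^ (1 * (1 + κ) * β / (1 + 2 * β)) * (n : ℝ) ^ (-(β / (2 * β + 1))) ≤
      htRate κ β n := by
  filter_upwards [tendsto_log_natCast_atTop.eventually_ge_atTop 1,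
    (Real.tendsto_log_atTop.comp tendsto_log_natCast_atTop).eventually_ge_atTop 1] with n h1 h2
  rw [htRate]
  refine mul_le_mul_of_nonneg_right ?_ (by positivity)
  have h3 : 1 ≤ Real.log (Real.log n) ^ (2 / (1 + 2 * β)) :=
    Real.one_le_rpow h2 (by positivity)
  have h4 : Real.log n ^ (1 * (1 + κ) * β / (1 + 2 * β)) ≤
      Real.log n ^ ((1 + (1 + κ) * β) / (1 + 2 * β)) := by
    refine Real.rpow_le_rpow_of_exponent_le h1 ?_
    gcongr
    linarith
  exact h4.trans (le_mul_of_one_le_left (by positivity) h3)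

end

theorem theorem8 (W : BoundaryWaveletBasis) (κ c₁ c₂ : ℝ) (hκ : 0 ≤ κ) (hc₁ : 0 < c₁)
    (hc₂ : 0 < c₂) (H : HeavyTailedDensity κ c₁ c₂) (β L : ℝ) (hβ : 0 < β) (hL : 0 < L) :
    (∀ α : ℝ, 1 / 2 < α → β ≤ α →
      PriorWellDefined W H (htScale α) ∧
      ∀ ρ : ℝ, 0 < ρ → ρ < 1 → ∃ M : ℝ, 0 < M ∧
        ∀ g₀ : unitInterval → ℝ, IsDensityAwayFromZero g₀ →
          (fun x => Real.log (g₀ x)) ∈ W.holderBall β L →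
          Tendsto (fun n : ℕ =>
            expectedPosteriorMass W H (htScale α) ρ g₀ n (M * htRate κ β n)) atTop (𝓝 0)) ∧
    (PriorWellDefined W H otScale ∧
      ∀ ρ : ℝ, 0 < ρ → ρ < 1 → ∃ M : ℝ, 0 < M ∧
        ∀ g₀ : unitInterval → ℝ, IsDensityAwayFromZero g₀ →
          (fun x => Real.log (g₀ x)) ∈ W.holderBall β L →
          Tendsto (fun n : ℕ =>
            expectedPosteriorMass W H otScale ρ g₀ n (M * otRate κ β n)) atTop (𝓝 0)) := by
  refine ⟨fun α hα hβα => ?_, ?_⟩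
  · have hs := regularScale_htScale (α := α) (by linarith)
    refine ⟨hs.priorWellDefined W hc₂ H hα, fun ρ hρ0 hρ1 => ?_⟩
    obtain ⟨M, hM0, hM⟩ := hs.exists_contraction_constant W hκ hc₁ hc₂ H hα le_rfl hβ hβα hL
      hρ0 hρ1
    exact ⟨M, hM0, fun g₀ hg₀ hball => hM g₀ hg₀ hball _
      ((eventually_le_htRate κ hβ).mono fun n hn => mul_le_mul_of_nonneg_left hn hM0.le)⟩
  -- As `α` is free for these scales, `max 1 β` meets both `α > 1/2` and `β ≤ α`, so `β` is
  -- unrestricted.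
  · have hα : 1 / 2 < max 1 β := lt_max_of_lt_left (by norm_num)
    have hs := regularScale_otScale (max 1 β)
    refine ⟨hs.priorWellDefined W hc₂ H hα, fun ρ hρ0 hρ1 => ?_⟩
    obtain ⟨M, hM0, hM⟩ := hs.exists_contraction_constant W hκ hc₁ hc₂ H hα one_le_two hβ
      (le_max_right _ _) hL hρ0 hρ1
    refine ⟨M, hM0, fun g₀ hg₀ hball => hM g₀ hg₀ hball _ (Eventually.of_forall fun n => ?_)⟩
    rw [otRate, show 2 * (1 + κ) * β / (1 + 2 * β) = (2 + 2 * κ) * β / (1 + 2 * β) by ring]
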